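/- Let $d\ge 2$ and $\lambda>0$. For a finite set $\Lambda\subset\mathbb Z^d$ let $Z_\Lambda=\sum_M\lambda^{|M|}$, the sum being over all matchings $M$ of the subgraph of the nearest-neighbour lattice $\mathbb Z^d$ induced by $\Lambda$ (the monomer-dimer model). For $a\in\mathbb R_{>0}^d$ let $B_{an}=\{u\in\mathbb Z^d:|u_j|\le a_jn,\ 1\le j\le d\}$ and $A(a)=\sum_{j}A_j(a)$ with $A_j(a)=\prod_{k\ne j}2a_k$. The free energy is $$\mathcal P(d,\lambda)=\lim_{n\to\infty}\frac{\log Z_{\Lambda_n}}{|\Lambda_n|}$$ along every sequence of nonempty finite sets $\Lambda_n\subset\mathbb Z^d$ with $|\partial\Lambda_n|/|\Lambda_n|\to0$, where $\partial\Lambda$ is the set of vertices of $\Lambda$ with a neighbour outside $\Lambda$; the surface pressure is $$s\mathcal P(d,\lambda,a)=\lim_{n\to\infty}\frac{\log Z_{B_{an}}-|B_{an}|\,\mathcal P(d,\lambda)}{A(a)\,n^{d-1}} .$$ For a subgraph $G$ of $\mathbb Z^d$, a vertex $v$ of $G$ and $t\ge0$ let $\Phi_G(v,0)=1$ and $\Phi_G(v,t+1)=\bigl(1+\lambda\sum_{u}\Phi_{G-v}(u,t)\bigr)^{-1}$,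 the sum being over the neighbours $u$ of $v$ in $G$. Let $\mathbb Z^d_{\preceq0}$ be the set consisting of the origin and of all vertices preceding it in the lexicographic order whose most significant coordinate is the last one, and let $\Phi(t)$, $\Phi_{j,k,+}(t)$, $\Phi_{j,k,-}(t)$ be the values $\Phi_G(0,t)$ for $G$ induced by $\mathbb Z^d_{\preceq0}$, by $\{v\in\mathbb Z^d_{\preceq0}:v_j\le k\}$ and by $\{v\in\mathbb Z^d_{\preceq0}:v_j\ge-k\}$, respectively. The sequential cavity algorithm (SCA) evaluates these recursions and, for a target error $\epsilon>0$, returns $$-\log\Phi(t)\quad\text{and}\quad\sum_{j=1}^d\frac{A_j(a)}{A(a)}\sum_{k=0}^{t-1}\bigl(2\log\Phi(t)-\log\Phi_{j,k,+}(t)-\log\Phi_{j,k,-}(t)\bigr)$$ as its estimates of $\mathcal P(d,\lambda)$ and $s\mathcal P(d,\lambda,a)$. The depth is $t=2\lceil 10\,s\,(1+\log(1+1/\delta))\rceil$, where $s=\sqrt{1+2\lambda d}$, with $\delta=\epsilon$ for the free energy and $\delta=\epsilon/s$ for the surface pressure. Time is the number of elementary steps, with unit cost for operations on real numbers (arithmetic,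 comparison, square root, logarithm) and on integers. There is a universal constant $C>0$ such that for all $d\ge2$, $\lambda>0$ the limit $\mathcal P(d,\lambda)$ exists, for all $a\in\mathbb R_{>0}^d$ the limit $s\mathcal P(d,\lambda,a)$ exists, and for every $\epsilon>0$ the SCA produces 1. an estimate of $\mathcal P(d,\lambda)$ with additive error at most $\epsilon$ in time at most $\log(2+2\lambda d)\,\bigl(2+\tfrac1\epsilon\bigr)^{C(1+\lambda d)^{1/2}\log d}$; 2. an estimate of $s\mathcal P(d,\lambda,a)$ with additive error at most $\epsilon$ in time at most $\log(2+2\lambda d)\,\bigl(2+\lambda d+\tfrac1\epsilon\bigr)^{C(1+\lambda d)^{1/2}\log d}$. -/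

import Mathlib

open Topology

/-! ### The lattice and the monomer-dimer partition function -/

/-- The nearest-neighbour graph on `ℤ^d`: `u` and `v` are adjacent iff their `ℓ¹`-distance is `1`. -/
def latticeGraph (d : ℕ) : SimpleGraph (Fin d → ℤ) where
  Adj u v := ∑ i, |u i - v i| = 1
  symm := ⟨fun u v h => by simpa only [abs_sub_comm] using h⟩
  loopless := ⟨fun v h => by simp at h⟩

/-- `M` is a matching of `G`: a set of edges of `G`, no two of which share a vertex. -/
def IsMatchingSet {V : Type*} (G : SimpleGraph V) (M : Finset (Sym2 V)) : Prop :=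
  (∀ e ∈ M, e ∈ G.edgeSet) ∧ ∀ e ∈ M, ∀ f ∈ M, e ≠ f → ∀ v, v ∈ e → v ∉ f

open Classical in
/-- The partition function `∑_M lam ^ |M|`, over all matchings `M` of the subgraph of `ℤ^d` induced
by the finite set `S` (`S.sym2` is the set of unordered pairs of elements of `S`). -/
noncomputable def partitionFunction (d : ℕ) (lam : ℝ) (S : Finset (Fin d → ℤ)) : ℝ :=
  ∑ M ∈ S.sym2.powerset with IsMatchingSet (latticeGraph d) M, lam ^ M.card

open Classical in
/-- The inner boundary of `S`: the vertices of `S` with a neighbour outside `S`. -/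
noncomputable def innerBoundary (d : ℕ) (S : Finset (Fin d → ℤ)) : Finset (Fin d → ℤ) :=
  S.filter fun v => ∃ u, (latticeGraph d).Adj v u ∧ u ∉ S

/-- Van Hove sequences of nonempty finite subsets of `ℤ^d`. -/
def IsVanHove (d : ℕ) (S : ℕ → Finset (Fin d → ℤ)) : Prop :=
  (∀ n, (S n).Nonempty) ∧
    Filter.Tendsto (fun n => ((innerBoundary d (S n)).card : ℝ) / ((S n).card : ℝ)) Filter.atTop (𝓝 0)

/-- `P` is the free energy (pressure): `log Z_S / |S|` tends to `P` along every van Hove sequence. -/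
def IsFreeEnergy (d : ℕ) (lam P : ℝ) : Prop :=
  ∀ S : ℕ → Finset (Fin d → ℤ), IsVanHove d S →
    Filter.Tendsto (fun n => Real.log (partitionFunction d lam (S n)) / ((S n).card : ℝ)) Filter.atTop (𝓝 P)

/-- The box `{u ∈ ℤ^d : |u_j| ≤ a_j n for all j}`. -/
noncomputable def rectBox {d : ℕ} (a : Fin d → ℝ) (n : ℕ) : Finset (Fin d → ℤ) :=
  Fintype.piFinset fun i => Finset.Icc (-⌊a i * n⌋) ⌊a i * n⌋

/-- The rescaled surface area `A(a) = ∑_j ∏_{k ≠ j} (2 a_k)`. -/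
noncomputable def surfaceArea {d : ℕ} (a : Fin d → ℝ) : ℝ :=
  ∑ j, ∏ k ∈ Finset.univ.erase j, (2 * a k)

/-- `s` is the surface pressure for the rectangular shape `a`, where `P` is the free energy:
`(log Z_B - |B| P) / (A(a) n^(d-1))` tends to `s`, where `B` is the box of shape `a` and scale `n`. -/
def IsSurfacePressure (d : ℕ) (lam P : ℝ) (a : Fin d → ℝ) (s : ℝ) : Prop :=
  Filter.Tendsto (fun n : ℕ =>
    (Real.log (partitionFunction d lam (rectBox a n)) - ((rectBox a n).card : ℝ) * P) /
      (surfaceArea a * (n : ℝ) ^ (d - 1))) Filter.atTop (𝓝 s)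

/-! ### Subsets of the lattice used by the algorithm -/

/-- The lexicographic order on `ℤ^d` in which the last coordinate is the most significant one. -/
def lexPrec {d : ℕ} (v u : Fin d → ℤ) : Prop :=
  ∃ k, v k < u k ∧ ∀ j, k < j → v j = u j

/-- The vertices preceding the origin, together with the origin. -/
def cavityHalf (d : ℕ) : Set (Fin d → ℤ) := {u | lexPrec u 0 ∨ u = 0}

/-- The part of `cavityHalf d` in the half-space `u_j ≤ k`. -/
def cavityUpper (d : ℕ) (j : Fin d) (k : ℕ) : Set (Fin d → ℤ) :=
  {u | u ∈ cavityHalf d ∧ u j ≤ (k : ℤ)}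

/-- The part of `cavityHalf d` in the half-space `u_j ≥ -k`. -/
def cavityLower (d : ℕ) (j : Fin d) (k : ℕ) : Set (Fin d → ℤ) :=
  {u | u ∈ cavityHalf d ∧ -(k : ℤ) ≤ u j}

/-- The `2d` unit steps of the lattice. -/
def unitSteps (d : ℕ) : List (Fin d → ℤ) :=
  (List.finRange d).flatMap fun i => [Pi.single i 1, Pi.single i (-1)]

/-! ### Computations with a step count

The machine works with unit cost on real numbers and integers: each arithmetic operation,
comparison, square root or logarithm, each list operation and each pass through a loop is one step.
An operation on vertices of `ℤ^d` is charged for each of the coordinates. -/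

/-- The result of a computation together with the number of elementary steps it has taken. -/
structure Timed (α : Type) where
  val : α
  steps : ℕ

namespace Timed

instance : Monad Timed where
  pure x := ⟨x, 0⟩
  bind m f := ⟨(f m.val).val, m.steps + (f m.val).steps⟩

/-- A computation of `x` that takes `c` elementary steps. -/
def instr {α : Type} (c : ℕ) (x : α) : Timed α := ⟨x, c⟩

/-- One pass through a loop. -/
def tick : Timed Unit := instr 1 ()

noncomputable def add (x y : ℝ) : Timed ℝ := instr 1 (x + y)
noncomputable def sub (x y : ℝ) : Timed ℝ := instr 1 (x - y)
noncomputable def mul (x y : ℝ) : Timed ℝ := instr 1 (x * y)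
noncomputable def div (x y : ℝ) : Timed ℝ := instr 1 (x / y)
noncomputable def sqrt (x : ℝ) : Timed ℝ := instr 1 (Real.sqrt x)
noncomputable def log (x : ℝ) : Timed ℝ := instr 1 (Real.log x)

/-- Rounding up to a natural number, by counting upwards from `0` until `x` is reached. -/
noncomputable def ceil (x : ℝ) : Timed ℕ := instr (2 * ⌈x⌉₊ + 1) ⌈x⌉₊

/-- The vertex `v + e`, one step for each coordinate. -/
def translate {d : ℕ} (v e : Fin d → ℤ) : Timed (Fin d → ℤ) := instr d (v + e)

open Classical in
/-- Test whether `u` lies in `R`. This is used only when `R` is `cavityHalf d` or its intersection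
with a coordinate half-space: scanning the `d` coordinates from the last one (each is compared
with `0` from both sides) and one comparison for the half-space. -/
noncomputable def inRegion {d : ℕ} (R : Set (Fin d → ℤ)) (u : Fin d → ℤ) : Timed Bool :=
  instr (2 * d + 1) (decide (u ∈ R))

/-- Test whether `u` occurs in the list `Y`, by comparing it with all entries. -/
def inList {d : ℕ} (Y : List (Fin d → ℤ)) (u : Fin d → ℤ) : Timed Bool :=
  instr (Y.length * (d + 1) + 1) (decide (u ∈ Y))

end Timed

/-! ### The sequential cavity algorithm -/

/-- The truncated cavity recursion. With `G` the subgraph of `ℤ^d` induced by the vertices of `R`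
that are not in the list `X`, this computes `Φ_G(v, t)`, where `Φ_G(v, 0) = b` and
`Φ_G(v, t + 1) = 1 / (1 + lam * ∑_u Φ_{G - v}(u, t))`, the sum being over the neighbours of `v`
in `G`. -/
noncomputable def cavity {d : ℕ} (lam : ℝ) (R : Set (Fin d → ℤ)) (b : ℝ) :
    ℕ → List (Fin d → ℤ) → (Fin d → ℤ) → Timed ℝ
  | 0, _, _ => Timed.instr 1 b
  | t + 1, X, v => do
    let Y ← Timed.instr 1 (v :: X)
    let s ← (unitSteps d).foldlM (init := (0 : ℝ)) fun s e => do
      Timed.tick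
      let u ← Timed.translate v e
      let inside ← Timed.inRegion R u
      let removed ← Timed.inList Y u
      if inside && !removed then
        let x ← cavity lam R b t Y u
        Timed.add s x
      else
        pure s
    let p ← Timed.mul lam s
    let q ← Timed.add 1 p
    Timed.div 1 q

/-- The number `√(1 + 2 * lam * d)`. -/
noncomputable def scaScale (d : ℕ) (lam : ℝ) : Timed ℝ := do
  let x ← Timed.mul 2 lam
  let y ← Timed.mul x d
  let z ← Timed.add 1 y
  Timed.sqrt z

/-- The depth `2 * ⌈10 * √(1 + 2 * lam * d) * (1 + log (1 + 1 / δ))⌉` of the recursion. -/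
noncomputable def scaDepth (d : ℕ) (lam δ : ℝ) : Timed ℕ := do
  let s ← scaScale d lam
  let x ← Timed.div 1 δ
  let y ← Timed.add 1 x
  let l ← Timed.log y
  let z ← Timed.add 1 l
  let w ← Timed.mul s z
  let r ← Timed.mul 10 w
  let m ← Timed.ceil r
  Timed.instr 1 (2 * m)

/-- `log Φ(t)`, where `Φ` is the truncated cavity recursion at the origin in the region `R`, with
the value `1` at depth `0`. -/
noncomputable def logCavity {d : ℕ} (lam : ℝ) (R : Set (Fin d → ℤ)) (t : ℕ) : Timed ℝ := do
  let o ← Timed.instr d (0 : Fin d → ℤ)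
  let x ← cavity lam R 1 t [] o
  Timed.log x

/-- The sequential cavity algorithm for the free energy. -/
noncomputable def scaFreeEnergy (d : ℕ) (lam ε : ℝ) : Timed ℝ := do
  let t ← scaDepth d lam ε
  let l ← logCavity lam (cavityHalf d) t
  Timed.sub 0 l

/-- The sequential cavity algorithm for the surface pressure of the shape `a`. It returns
`∑_j (A_j(a) / A(a)) * ∑_{k < t} (2 log Φ - log Φ_{j,k,+} - log Φ_{j,k,-})`, all at depth `t`;
note that `A_j(a) / A(a) = (1 / a_j) / ∑_i (1 / a_i)`. -/
noncomputable def scaSurfacePressure (d : ℕ) (lam : ℝ) (a : Fin d → ℝ) (ε : ℝ) : Timed ℝ := do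
  let s ← scaScale d lam
  let δ ← Timed.div ε s
  let t ← scaDepth d lam δ
  let l ← logCavity lam (cavityHalf d) t
  let l2 ← Timed.mul 2 l
  let total ← (List.finRange d).foldlM (init := (0 : ℝ)) fun w i => do
    Timed.tick
    let x ← Timed.div 1 (a i)
    Timed.add w x
  (List.finRange d).foldlM (init := (0 : ℝ)) fun r j => do
    Timed.tick
    let acc ← (List.range t).foldlM (init := (0 : ℝ)) fun c k => do
      Timed.tick
      let up ← logCavity lam (cavityUpper d j k) t
      let low ← logCavity lam (cavityLower d j k) t
      let x ← Timed.sub l2 up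
      let y ← Timed.sub x low
      Timed.add c y
    let x ← Timed.div 1 (a j)
    let w ← Timed.div x total
    let z ← Timed.mul w acc
    Timed.add r z

/-!
The telescoping identity `log Z_Λ = -∑_v log Φ_v`, where `Φ_v` is the probability that the vertex
`v` is unmatched after the vertices following it have been deleted, reduces both limits to the
cavity recursion at single vertices. Two steps of the recursion contract: an error factor
`coth² θ` becomes `coth² (θ + φ)` with `φ = 1 / √(1 + 2λd)`, so `log Φ(t)` converges exponentially
fast, at a rate of order `1 / √(1 + 2λd)`. Since `Φ(t)` depends only on the vertices within
distance `t`, the vertices far from the boundary of `Λ` all contribute the same amount, which is the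
free energy; in a box the next order comes from the vertices that see exactly one face, and
those that see two faces are negligible. The same contraction bounds the error of the algorithm at
the depth it chooses, while its running time is the number of paths of that length in `ℤ^d`.
-/

/-! ### Contraction of the cavity recursion -/

section

theorem sinh_le_self_mul_cosh {x : ℝ} (hx : 0 ≤ x) : Real.sinh x ≤ x * Real.cosh x := by
  have hmono : MonotoneOn (fun y : ℝ => y * Real.cosh y - Real.sinh y) (Set.Ici 0) := by
    refine monotoneOn_of_hasDerivWithinAt_nonneg (f' := fun y => y * Real.sinh y) (convex_Ici 0)
      (by fun_prop) (fun y _ => ?_) (fun y hy => ?_)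
    · have h : HasDerivAt (fun y : ℝ => y * Real.cosh y - Real.sinh y)
          (1 * Real.cosh y + y * Real.sinh y - Real.cosh y) y :=
        ((hasDerivAt_id y).mul (Real.hasDerivAt_cosh y)).sub (Real.hasDerivAt_sinh y)
      exact (h.congr_deriv (by ring)).hasDerivWithinAt
    · rw [interior_Ici] at hy
      exact mul_nonneg (le_of_lt hy) (Real.sinh_nonneg_iff.2 (le_of_lt hy))
  have h := hmono Set.self_mem_Ici (Set.mem_Ici.2 hx) hx
  simp only [zero_mul, Real.sinh_zero, sub_zero] at h
  linarith

theorem mul_sinh_one_div_sqrt_sq_le_one {D : ℝ} (hD : 0 ≤ D) :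
    D * Real.sinh (1 / √(1 + D)) ^ 2 ≤ 1 := by
  set x := 1 / √(1 + D) with hx
  have hx0 : 0 ≤ x := by positivity
  have hxD : (1 + D) * x ^ 2 = 1 := by
    rw [hx, div_pow, Real.sq_sqrt (by linarith)]
    field_simp
  have hsq : Real.sinh x ^ 2 ≤ x ^ 2 * (Real.sinh x ^ 2 + 1) := by
    rw [← Real.cosh_sq, ← mul_pow]
    exact pow_le_pow_left₀ (Real.sinh_nonneg_iff.2 hx0) (sinh_le_self_mul_cosh hx0) 2
  linear_combination (1 + D) * hsq + (Real.sinh x ^ 2 + 1) * hxD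

theorem one_div_sinh_sq_anti {x y : ℝ} (hx : 0 < x) (hxy : x ≤ y) :
    1 / Real.sinh y ^ 2 ≤ 1 / Real.sinh x ^ 2 := by
  have hsinh : 0 < Real.sinh x := Real.sinh_pos_iff.2 hx
  exact one_div_le_one_div_of_le (by positivity)
    (pow_le_pow_left₀ hsinh.le (Real.sinh_le_sinh.2 hxy) 2)

theorem one_div_sinh_sq_le {x₀ x : ℝ} (hx₀ : 0 < x₀) (hx : x₀ ≤ x) :
    1 / Real.sinh x ^ 2 ≤ 4 / (1 - Real.exp (-(2 * x₀))) ^ 2 * Real.exp (-(2 * x)) := by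
  have hlt : Real.exp (-(2 * x₀)) < 1 := Real.exp_lt_one_iff.2 (by linarith)
  have hsinh : Real.sinh x = Real.exp x * (1 - Real.exp (-(2 * x))) / 2 := by
    rw [Real.sinh_eq, mul_sub, ← Real.exp_add]
    ring_nf
  have hle : Real.exp x * (1 - Real.exp (-(2 * x₀))) / 2 ≤ Real.sinh x := by
    rw [hsinh]
    gcongr
  have hpos : 0 < Real.exp x * (1 - Real.exp (-(2 * x₀))) / 2 := by
    have := sub_pos.2 hlt
    positivity
  calc 1 / Real.sinh x ^ 2 ≤ 1 / (Real.exp x * (1 - Real.exp (-(2 * x₀))) / 2) ^ 2 :=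
      one_div_le_one_div_of_le (by positivity) (pow_le_pow_left₀ hpos.le hle 2)
    _ = 4 / (1 - Real.exp (-(2 * x₀))) ^ 2 * Real.exp (-(2 * x)) := by
      rw [show -(2 * x) = -x + -x by ring, Real.exp_add, Real.exp_neg x, div_pow, mul_pow]
      generalize 1 - Real.exp (-(2 * x₀)) = a
      ring

/-! If `y` is at most `coth² θ` times `y'`, then two further levels of the recursion improve the
factor to `coth² (θ + φ)`, provided that `card * lam * sinh² φ ≤ 1`. Writing the hypotheses with
`sinh` and `cosh` makes the iteration of this step additive in `θ`. -/

theorem cavityRatio_inner {ι : Type*} {I : Finset ι} {y y' : ι → ℝ} {lam θ : ℝ} (hlam : 0 ≤ lam)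
    (hy : ∀ i ∈ I, 0 ≤ y i) (hy' : ∀ i ∈ I, 0 ≤ y' i)
    (h : ∀ i ∈ I, Real.sinh θ ^ 2 * y i ≤ Real.cosh θ ^ 2 * y' i) :
    Real.sinh θ ^ 2 * (1 / (1 + lam * ∑ i ∈ I, y' i)) ≤
      1 / (1 + lam * ∑ i ∈ I, y i) * (Real.cosh θ ^ 2 - 1 / (1 + lam * ∑ i ∈ I, y' i)) := by
  have hS : 0 ≤ lam * ∑ i ∈ I, y i := mul_nonneg hlam (Finset.sum_nonneg hy)
  have hS' : 0 ≤ lam * ∑ i ∈ I, y' i := mul_nonneg hlam (Finset.sum_nonneg hy')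
  have hle : Real.sinh θ ^ 2 * (lam * ∑ i ∈ I, y i) ≤
      Real.cosh θ ^ 2 * (lam * ∑ i ∈ I, y' i) := by
    rw [mul_left_comm, mul_left_comm (Real.cosh θ ^ 2), Finset.mul_sum I y, Finset.mul_sum I y']
    exact mul_le_mul_of_nonneg_left (Finset.sum_le_sum h) hlam
  set S := lam * ∑ i ∈ I, y i
  set S' := lam * ∑ i ∈ I, y' i
  have hdiff : 1 / (1 + S) * (Real.cosh θ ^ 2 - 1 / (1 + S')) -
        Real.sinh θ ^ 2 * (1 / (1 + S')) =
      (Real.cosh θ ^ 2 * S' - Real.sinh θ ^ 2 * S) / ((1 + S) * (1 + S')) := by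
    rw [Real.cosh_sq]
    field_simp
    ring
  rw [← sub_nonneg, hdiff]
  exact div_nonneg (sub_nonneg.2 hle) (by positivity)

theorem cavityRatio_vertex {x x' θ φ : ℝ} (hx' : x' ≤ 1) (hθ : 0 < Real.sinh θ)
    (h : Real.sinh θ ^ 2 * x' ≤ x * (Real.cosh θ ^ 2 - x')) :
    Real.sinh (θ + φ) ^ 2 * x' - Real.cosh (θ + φ) ^ 2 * x ≤ Real.sinh φ ^ 2 := by
  have hθ₂ : Real.cosh θ ^ 2 = Real.sinh θ ^ 2 + 1 := Real.cosh_sq θ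
  have hφ₂ : Real.cosh φ ^ 2 = Real.sinh φ ^ 2 + 1 := Real.cosh_sq φ
  have hadd : Real.sinh (θ + φ) = Real.sinh θ * Real.cosh φ + Real.cosh θ * Real.sinh φ :=
    Real.sinh_add θ φ
  have hcross : 2 * Real.sinh (θ + φ) * (Real.cosh θ * Real.sinh φ) =
      Real.sinh (θ + φ) ^ 2 + Real.sinh φ ^ 2 - Real.sinh θ ^ 2 := by
    rw [hadd]
    linear_combination Real.sinh φ ^ 2 * hθ₂ - Real.sinh θ ^ 2 * hφ₂
  have hsquare : Real.sinh φ ^ 2 * (Real.cosh θ ^ 2 - x') -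
        (Real.sinh (θ + φ) ^ 2 * x' * (Real.cosh θ ^ 2 - x') -
          Real.cosh (θ + φ) ^ 2 * (Real.sinh θ ^ 2 * x')) =
      (Real.sinh (θ + φ) * x' - Real.cosh θ * Real.sinh φ) ^ 2 := by
    rw [Real.cosh_sq (θ + φ)]
    linear_combination x' * hcross - Real.sinh (θ + φ) ^ 2 * x' * hθ₂
  have hpos : 0 < Real.cosh θ ^ 2 - x' := by
    have := pow_pos hθ 2
    linarith
  refine le_of_mul_le_mul_right ?_ hpos
  have := mul_le_mul_of_nonneg_left h (sq_nonneg (Real.cosh (θ + φ)))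
  have := sq_nonneg (Real.sinh (θ + φ) * x' - Real.cosh θ * Real.sinh φ)
  linarith

theorem cavityRatio_outer {ι : Type*} {I : Finset ι} {x x' : ι → ℝ} {lam D θ φ : ℝ}
    (hlam : 0 ≤ lam) (hI : I.card * lam ≤ D) (hD : D * Real.sinh φ ^ 2 ≤ 1)
    (hθ : 0 < Real.sinh θ) (hx : ∀ i ∈ I, 0 ≤ x i) (hx' : ∀ i ∈ I, x' i ∈ Set.Icc 0 1)
    (h : ∀ i ∈ I, Real.sinh θ ^ 2 * x' i ≤ x i * (Real.cosh θ ^ 2 - x' i)) :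
    Real.sinh (θ + φ) ^ 2 * (1 / (1 + lam * ∑ i ∈ I, x i)) ≤
      Real.cosh (θ + φ) ^ 2 * (1 / (1 + lam * ∑ i ∈ I, x' i)) := by
  have hsum : Real.sinh (θ + φ) ^ 2 * ∑ i ∈ I, x' i - Real.cosh (θ + φ) ^ 2 * ∑ i ∈ I, x i ≤
      I.card * Real.sinh φ ^ 2 := by
    rw [Finset.mul_sum, Finset.mul_sum, ← Finset.sum_sub_distrib, ← nsmul_eq_mul]
    exact Finset.sum_le_card_nsmul I _ _ fun i hi => cavityRatio_vertex (hx' i hi).2 hθ (h i hi)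
  have hS : 0 ≤ lam * ∑ i ∈ I, x i := mul_nonneg hlam (Finset.sum_nonneg hx)
  have hS' : 0 ≤ lam * ∑ i ∈ I, x' i :=
    mul_nonneg hlam (Finset.sum_nonneg fun i hi => (hx' i hi).1)
  have hone : I.card * lam * Real.sinh φ ^ 2 ≤ 1 :=
    (mul_le_mul_of_nonneg_right hI (sq_nonneg _)).trans hD
  have hscaled := mul_le_mul_of_nonneg_left hsum hlam
  rw [mul_one_div, mul_one_div, div_le_div_iff₀ (by linarith) (by linarith),
    Real.cosh_sq (θ + φ)] at *
  linarith

end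

/-! ### The cavity recursion on a locally finite graph -/

section

open Filter

variable {V : Type*} {G : SimpleGraph V} [G.LocallyFinite] {lam D : ℝ}

open Classical in
/-- The neighbours of `v` that lie in `R`. -/
noncomputable def neighborsIn (G : SimpleGraph V) [G.LocallyFinite] (R : Set V) (v : V) :
    Finset V :=
  {u ∈ G.neighborFinset v | u ∈ R}

theorem mem_neighborsIn {R : Set V} {v u : V} : u ∈ neighborsIn G R v ↔ G.Adj v u ∧ u ∈ R := by
  simp [neighborsIn]

theorem card_neighborsIn_le (R : Set V) (v : V) : (neighborsIn G R v).card ≤ G.degree v := by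
  classical exact Finset.card_filter_le _ _

/-- The truncated cavity recursion `Φ(v, t)` in the subgraph of `G` induced by `R`. Deleting `v`
from the graph is encoded by passing to `R \ {v}`. -/
noncomputable def cavityValue (G : SimpleGraph V) [G.LocallyFinite] (lam : ℝ) :
    ℕ → Set V → V → ℝ
  | 0, _, _ => 1
  | t + 1, R, v => 1 / (1 + lam * ∑ u ∈ neighborsIn G R v, cavityValue G lam t (R \ {v}) u)

theorem cavityValue_succ (t : ℕ) (R : Set V) (v : V) :
    cavityValue G lam (t + 1) R v =
      1 / (1 + lam * ∑ u ∈ neighborsIn G R v, cavityValue G lam t (R \ {v}) u) :=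
  rfl

theorem cavityValue_pos (hlam : 0 ≤ lam) (t : ℕ) (R : Set V) (v : V) :
    0 < cavityValue G lam t R v := by
  induction t generalizing R v with
  | zero => exact one_pos
  | succ t ih =>
    have hsum : 0 ≤ ∑ u ∈ neighborsIn G R v, cavityValue G lam t (R \ {v}) u :=
      Finset.sum_nonneg fun u _ => (ih _ u).le
    rw [cavityValue_succ]
    positivity

theorem nonneg_of_degree_mul_le (hlam : 0 ≤ lam) (hdeg : ∀ v, G.degree v * lam ≤ D) (v : V) :
    0 ≤ D :=
  (by positivity : (0 : ℝ) ≤ G.degree v * lam).trans (hdeg v)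

theorem cavityValue_mem_Icc (hlam : 0 ≤ lam) (hdeg : ∀ v, G.degree v * lam ≤ D) (t : ℕ)
    (R : Set V) (v : V) : cavityValue G lam t R v ∈ Set.Icc (1 / (1 + D)) 1 := by
  have hD := nonneg_of_degree_mul_le hlam hdeg v
  induction t generalizing R v with
  | zero => exact ⟨(div_le_one (by linarith)).2 (by linarith), le_rfl⟩
  | succ t ih =>
    rw [cavityValue_succ]
    have hnonneg : 0 ≤ ∑ u ∈ neighborsIn G R v, cavityValue G lam t (R \ {v}) u :=
      Finset.sum_nonneg fun u _ => (cavityValue_pos hlam t _ u).le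
    have hle : ∑ u ∈ neighborsIn G R v, cavityValue G lam t (R \ {v}) u ≤ G.degree v :=
      calc ∑ u ∈ neighborsIn G R v, cavityValue G lam t (R \ {v}) u
        _ ≤ (neighborsIn G R v).card • 1 := Finset.sum_le_card_nsmul _ _ _ fun u _ => (ih _ _).2
        _ ≤ G.degree v := by
          rw [nsmul_one]
          exact_mod_cast card_neighborsIn_le R v
    have hprod := mul_nonneg hlam hnonneg
    refine ⟨one_div_le_one_div_of_le (by linarith) ?_, (div_le_one (by linarith)).2 (by linarith)⟩
    linarith [mul_le_mul_of_nonneg_left hle hlam, hdeg v]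

theorem sinh_sq_mul_cavityValue_le (hlam : 0 ≤ lam) (hdeg : ∀ v, G.degree v * lam ≤ D) {φ : ℝ}
    (hφ : 0 < φ) (hD : D * Real.sinh φ ^ 2 ≤ 1) (k r r' : ℕ) (R : Set V) (v : V) :
    Real.sinh ((k + 1) * φ) ^ 2 * cavityValue G lam (2 * k + r) R v ≤
      Real.cosh ((k + 1) * φ) ^ 2 * cavityValue G lam (2 * k + r') R v := by
  induction k generalizing R v with
  | zero =>
    have hD0 := nonneg_of_degree_mul_le hlam hdeg v
    have hle := (cavityValue_mem_Icc hlam hdeg r R v).2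
    have hge := (cavityValue_mem_Icc hlam hdeg r' R v).1
    simp only [Nat.cast_zero, mul_zero, zero_add, one_mul]
    calc Real.sinh φ ^ 2 * cavityValue G lam r R v ≤ Real.sinh φ ^ 2 :=
          mul_le_of_le_one_right (sq_nonneg _) hle
      _ ≤ Real.cosh φ ^ 2 * (1 / (1 + D)) := by
          rw [mul_one_div, le_div_iff₀ (by linarith), Real.cosh_sq]
          linarith
      _ ≤ Real.cosh φ ^ 2 * cavityValue G lam r' R v := by gcongr
  | succ k ih =>
    have hinner (u : V) := cavityRatio_inner (I := neighborsIn G (R \ {v}) u) hlam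
      (fun w _ => (cavityValue_pos hlam (2 * k + r) ((R \ {v}) \ {u}) w).le)
      (fun w _ => (cavityValue_pos hlam (2 * k + r') ((R \ {v}) \ {u}) w).le)
      (fun w _ => ih ((R \ {v}) \ {u}) w)
    have hcard : ((neighborsIn G R v).card : ℝ) * lam ≤ D := by
      refine (mul_le_mul_of_nonneg_right ?_ hlam).trans (hdeg v)
      exact_mod_cast card_neighborsIn_le R v
    have houter := cavityRatio_outer hlam hcard hD (Real.sinh_pos_iff.2 (by positivity))
      (fun u _ => (cavityValue_pos hlam (2 * k + r + 1) (R \ {v}) u).le)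
      (fun u _ => ⟨(cavityValue_pos hlam (2 * k + r' + 1) (R \ {v}) u).le,
        (cavityValue_mem_Icc hlam hdeg _ _ _).2⟩) (fun u _ => hinner u)
    rw [← add_one_mul] at houter
    rw [Nat.cast_succ, show 2 * (k + 1) + r = 2 * k + r + 1 + 1 by ring,
      show 2 * (k + 1) + r' = 2 * k + r' + 1 + 1 by ring]
    exact houter

/-- A bound for the error in `log Φ(v, n)` when `D` bounds `lam` times the degrees. -/
noncomputable def cavityError (D : ℝ) (n : ℕ) : ℝ :=
  1 / Real.sinh ((n + 1) / (2 * √(1 + D))) ^ 2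

theorem cavityError_nonneg (D : ℝ) (n : ℕ) : 0 ≤ cavityError D n :=
  one_div_nonneg.2 (sq_nonneg _)

theorem cavityError_le_mul_exp {x₀ : ℝ} (hx₀ : 0 < x₀) {n : ℕ}
    (h : x₀ ≤ (n + 1) / (2 * √(1 + D))) :
    cavityError D n ≤
      4 / (1 - Real.exp (-(2 * x₀))) ^ 2 * Real.exp (-((n + 1) / √(1 + D))) := by
  refine (one_div_sinh_sq_le hx₀ h).trans_eq ?_
  congr 3
  ring

theorem cavityError_le_sixteen_mul_exp (hD : 0 ≤ D) {n : ℕ} (h : 2 * √(1 + D) ≤ n + 1) :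
    cavityError D n ≤ 16 * Real.exp (-((n + 1) / √(1 + D))) := by
  have hs : 0 < √(1 + D) := Real.sqrt_pos.2 (by linarith)
  refine (cavityError_le_mul_exp one_pos ((one_le_div₀ (mul_pos two_pos hs)).2 h)).trans ?_
  have hexp : Real.exp (-(2 * 1)) ≤ 1 / 2 := by
    rw [Real.exp_neg, ← one_div]
    exact one_div_le_one_div_of_le two_pos (by linarith [Real.add_one_le_exp (2 * 1 : ℝ)])
  have hsq : (1 / 2 : ℝ) ^ 2 ≤ (1 - Real.exp (-(2 * 1))) ^ 2 :=
    pow_le_pow_left₀ (by norm_num) (by linarith) 2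
  gcongr
  calc 4 / (1 - Real.exp (-(2 * 1))) ^ 2 ≤ 4 / (1 / 2) ^ 2 := by gcongr
    _ = 16 := by norm_num

theorem tendsto_cavityError (hD : 0 ≤ D) : Tendsto (cavityError D) atTop (𝓝 0) := by
  have hs : 0 < √(1 + D) := Real.sqrt_pos.2 (by linarith)
  have hbound : Tendsto (fun n : ℕ => 16 * Real.exp (-((n + 1) / √(1 + D)))) atTop (𝓝 0) := by
    have hlin : Tendsto (fun n : ℕ => ((n : ℝ) + 1) / √(1 + D)) atTop atTop :=
      (tendsto_atTop_add_const_right _ 1 tendsto_natCast_atTop_atTop).atTop_div_const hs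
    simpa using (Real.tendsto_exp_neg_atTop_nhds_zero.comp hlin).const_mul 16
  refine squeeze_zero' (.of_forall (cavityError_nonneg D)) ?_ hbound
  filter_upwards [eventually_ge_atTop ⌈2 * √(1 + D)⌉₊] with n hn
  exact cavityError_le_sixteen_mul_exp hD ((Nat.ceil_le.1 hn).trans (by linarith))

theorem log_cavityValue_sub_le (hlam : 0 ≤ lam) (hdeg : ∀ v, G.degree v * lam ≤ D) (R : Set V)
    (v : V) {n m m' : ℕ} (hm : n ≤ m) (hm' : n ≤ m') :
    Real.log (cavityValue G lam m R v) - Real.log (cavityValue G lam m' R v) ≤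
      cavityError D n := by
  have hD := nonneg_of_degree_mul_le hlam hdeg v
  have hφ : 0 < 1 / √(1 + D) := by positivity
  set θ := ((n / 2 : ℕ) + 1) * (1 / √(1 + D)) with hθ
  have hθpos : 0 < θ := by positivity
  have hsinh : 0 < Real.sinh θ := Real.sinh_pos_iff.2 hθpos
  have hratio := sinh_sq_mul_cavityValue_le hlam hdeg hφ (mul_sinh_one_div_sqrt_sq_le_one hD)
    (n / 2) (m - 2 * (n / 2)) (m' - 2 * (n / 2)) R v
  rw [← hθ, Nat.add_sub_cancel' (by omega), Nat.add_sub_cancel' (by omega)] at hratio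
  have hpos := cavityValue_pos (G := G) hlam m R v
  have hpos' := cavityValue_pos (G := G) hlam m' R v
  calc Real.log (cavityValue G lam m R v) - Real.log (cavityValue G lam m' R v)
    _ = Real.log (cavityValue G lam m R v / cavityValue G lam m' R v) :=
        (Real.log_div hpos.ne' hpos'.ne').symm
    _ ≤ cavityValue G lam m R v / cavityValue G lam m' R v - 1 :=
        Real.log_le_sub_one_of_pos (by positivity)
    _ ≤ Real.cosh θ ^ 2 / Real.sinh θ ^ 2 - 1 := by
        refine sub_le_sub_right ((div_le_div_iff₀ hpos' (pow_pos hsinh 2)).2 ?_) 1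
        linarith
    _ = 1 / Real.sinh θ ^ 2 := by
        rw [Real.cosh_sq]
        field_simp
        ring
    _ ≤ cavityError D n := by
        have hhalf : (n + 1 : ℝ) ≤ 2 * ((n / 2 : ℕ) + 1) := by
          exact_mod_cast (by omega : n + 1 ≤ 2 * (n / 2 + 1))
        have hle : (n + 1) / (2 * √(1 + D)) ≤ θ := by
          rw [hθ, mul_one_div, div_le_div_iff₀ (by positivity) (by positivity)]
          nlinarith [Real.sqrt_nonneg (1 + D)]
        exact one_div_sinh_sq_anti (by positivity) hle

/-- The logarithm of `lim Φ(v, t)` as `t → ∞`. -/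
noncomputable def logCavityLimit (G : SimpleGraph V) [G.LocallyFinite] (lam : ℝ) (R : Set V)
    (v : V) : ℝ :=
  limUnder atTop fun t => Real.log (cavityValue G lam t R v)

theorem tendsto_log_cavityValue (hlam : 0 ≤ lam) (hdeg : ∀ v, G.degree v * lam ≤ D) (R : Set V)
    (v : V) :
    Tendsto (fun t => Real.log (cavityValue G lam t R v)) atTop (𝓝 (logCavityLimit G lam R v)) := by
  refine CauchySeq.tendsto_limUnder (cauchySeq_of_le_tendsto_0 (cavityError D) ?_
    (tendsto_cavityError (nonneg_of_degree_mul_le hlam hdeg v)))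
  exact fun m m' n hm hm' => abs_sub_le_iff.2 ⟨log_cavityValue_sub_le hlam hdeg R v hm hm',
    log_cavityValue_sub_le hlam hdeg R v hm' hm⟩

theorem abs_log_cavityValue_sub_logCavityLimit_le (hlam : 0 ≤ lam)
    (hdeg : ∀ v, G.degree v * lam ≤ D) (R : Set V) (v : V) (t : ℕ) :
    |Real.log (cavityValue G lam t R v) - logCavityLimit G lam R v| ≤ cavityError D t := by
  refine le_of_tendsto ((tendsto_log_cavityValue hlam hdeg R v).const_sub _).abs ?_
  filter_upwards [eventually_ge_atTop t] with m hm
  exact abs_sub_le_iff.2 ⟨log_cavityValue_sub_le hlam hdeg R v le_rfl hm,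
    log_cavityValue_sub_le hlam hdeg R v hm le_rfl⟩

theorem abs_log_cavityValue_le (hlam : 0 ≤ lam) (hdeg : ∀ v, G.degree v * lam ≤ D) (t : ℕ)
    (R : Set V) (v : V) : |Real.log (cavityValue G lam t R v)| ≤ Real.log (1 + D) := by
  have hD := nonneg_of_degree_mul_le hlam hdeg v
  have hpos := cavityValue_pos (G := G) hlam t R v
  obtain ⟨hge, hle⟩ := cavityValue_mem_Icc hlam hdeg t R v
  rw [abs_of_nonpos (Real.log_nonpos hpos.le hle), neg_le, ← Real.log_inv, ← one_div]
  exact Real.log_le_log (by positivity) hge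

theorem abs_logCavityLimit_le (hlam : 0 ≤ lam) (hdeg : ∀ v, G.degree v * lam ≤ D) (R : Set V)
    (v : V) : |logCavityLimit G lam R v| ≤ Real.log (1 + D) :=
  le_of_tendsto' (tendsto_log_cavityValue hlam hdeg R v).abs fun t =>
    abs_log_cavityValue_le hlam hdeg t R v

/-! ### Locality and invariance under automorphisms -/

theorem cavityValue_congr {t : ℕ} {R R' : Set V} {v : V}
    (h : ∀ u, G.edist v u ≤ t → (u ∈ R ↔ u ∈ R')) :
    cavityValue G lam t R v = cavityValue G lam t R' v := by
  induction t generalizing R R' v with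
  | zero => rfl
  | succ t ih =>
    have hstep {u w : V} (hu : G.Adj v u) (hw : G.edist u w ≤ t) : G.edist v w ≤ (t + 1 : ℕ) := by
      rw [Nat.cast_succ, add_comm]
      exact SimpleGraph.edist_triangle.trans
        (add_le_add (SimpleGraph.edist_eq_one_iff_adj.2 hu).le hw)
    have hneighbors : neighborsIn G R v = neighborsIn G R' v := by
      ext u
      simp only [mem_neighborsIn]
      exact and_congr_right fun hu => h u (hstep hu (by simp))
    rw [cavityValue_succ, cavityValue_succ, hneighbors]
    congr 3
    refine Finset.sum_congr rfl fun u hu => ih fun w hw => ?_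
    exact and_congr_left' (h w (hstep (mem_neighborsIn.1 hu).1 hw))

theorem abs_logCavityLimit_sub_le (hlam : 0 ≤ lam) (hdeg : ∀ v, G.degree v * lam ≤ D) {t : ℕ}
    {R R' : Set V} {v : V} (h : ∀ u, G.edist v u ≤ t → (u ∈ R ↔ u ∈ R')) :
    |logCavityLimit G lam R v - logCavityLimit G lam R' v| ≤ 2 * cavityError D t := by
  have hR := abs_log_cavityValue_sub_logCavityLimit_le hlam hdeg R v t
  have hR' := abs_log_cavityValue_sub_logCavityLimit_le hlam hdeg R' v t
  rw [cavityValue_congr h, abs_sub_comm] at hR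
  linarith [abs_sub_le (logCavityLimit G lam R v) (Real.log (cavityValue G lam t R' v))
    (logCavityLimit G lam R' v)]

theorem cavityValue_preimage (φ : G ≃g G) (t : ℕ) (R : Set V) (v : V) :
    cavityValue G lam t (φ ⁻¹' R) v = cavityValue G lam t R (φ v) := by
  induction t generalizing R v with
  | zero => rfl
  | succ t ih =>
    have hdelete : φ ⁻¹' R \ {v} = φ ⁻¹' (R \ {φ v}) := by
      ext u
      simp
    rw [cavityValue_succ, cavityValue_succ, hdelete]
    congr 3
    refine Finset.sum_bij (fun u _ => φ u) (fun u hu => ?_) (fun _ _ _ _ h => φ.injective h)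
      (fun w hw => ⟨φ.symm w, ?_, φ.apply_symm_apply w⟩) (fun u _ => ih _ _)
    · rw [mem_neighborsIn] at hu ⊢
      exact ⟨φ.map_adj_iff.2 hu.1, hu.2⟩
    · rw [mem_neighborsIn] at hw ⊢
      rw [← φ.map_adj_iff]
      simpa using hw

theorem logCavityLimit_preimage (φ : G ≃g G) (R : Set V) (v : V) :
    logCavityLimit G lam (φ ⁻¹' R) v = logCavityLimit G lam R (φ v) := by
  simp only [logCavityLimit, cavityValue_preimage]

end

/-! ### Matchings -/

section

variable {V : Type*} {G : SimpleGraph V} {lam : ℝ}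

open Classical in
/-- The matchings of the subgraph of `G` induced by `S`. -/
noncomputable def matchings (G : SimpleGraph V) (S : Finset V) : Finset (Finset (Sym2 V)) :=
  {M ∈ S.sym2.powerset | IsMatchingSet G M}

/-- The matching polynomial of the subgraph of `G` induced by `S`, evaluated at `lam`. -/
noncomputable def matchingSum (G : SimpleGraph V) (lam : ℝ) (S : Finset V) : ℝ :=
  ∑ M ∈ matchings G S, lam ^ M.card

theorem partitionFunction_eq_matchingSum (d : ℕ) (lam : ℝ) (S : Finset (Fin d → ℤ)) :
    partitionFunction d lam S = matchingSum (latticeGraph d) lam S :=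
  rfl

theorem mem_matchings {S : Finset V} {M : Finset (Sym2 V)} :
    M ∈ matchings G S ↔ (∀ e ∈ M, ∀ a ∈ e, a ∈ S) ∧ IsMatchingSet G M := by
  simp [matchings, Finset.subset_iff, Finset.mem_sym2_iff]

theorem matchings_mono {S T : Finset V} (h : S ⊆ T) : matchings G S ⊆ matchings G T := by
  intro M hM
  rw [mem_matchings] at *
  exact ⟨fun e he a ha => h (hM.1 e he a ha), hM.2⟩

theorem matchings_empty : matchings G ∅ = {∅} := by
  ext M
  rw [mem_matchings, Finset.mem_singleton]
  constructor
  · rintro ⟨hM, -⟩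
    refine Finset.eq_empty_of_forall_notMem fun e he => ?_
    induction e with
    | _ a b => simpa using hM _ he a (Sym2.mem_mk_left a b)
  · rintro rfl
    simp [IsMatchingSet]

theorem matchingSum_empty : matchingSum G lam ∅ = 1 := by
  simp [matchingSum, matchings_empty]

theorem matchingSum_pos (hlam : 0 ≤ lam) (S : Finset V) : 0 < matchingSum G lam S := by
  have hempty : ∅ ∈ matchings G S :=
    matchings_mono (Finset.empty_subset S) (by simp [matchings_empty])
  exact Finset.sum_pos' (fun _ _ => by positivity) ⟨∅, hempty, by simp⟩

variable [DecidableEq V]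

theorem notMem_of_mem_matchings_erase {S : Finset V} {v : V} {M : Finset (Sym2 V)}
    (hM : M ∈ matchings G (S.erase v)) {e : Sym2 V} (he : v ∈ e) : e ∉ M := fun h => by
  simpa using (mem_matchings.1 hM).1 e h v he

theorem filter_matchings_forall_notMem (S : Finset V) (v : V) :
    {M ∈ matchings G S | ∀ e ∈ M, v ∉ e} = matchings G (S.erase v) := by
  ext M
  simp only [Finset.mem_filter, mem_matchings, Finset.mem_erase]
  constructor
  · rintro ⟨⟨hS, hM⟩, hv⟩
    exact ⟨fun e he a ha => ⟨fun h => hv e he (h ▸ ha), hS e he a ha⟩, hM⟩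
  · rintro ⟨hS, hM⟩
    exact ⟨⟨fun e he a ha => (hS e he a ha).2, hM⟩, fun e he ha => (hS e he v ha).1 rfl⟩

theorem insert_mem_matchings {S : Finset V} {v u : V} (hv : v ∈ S) (hu : u ∈ S) (huv : G.Adj v u)
    {M : Finset (Sym2 V)} (hM : M ∈ matchings G ((S.erase v).erase u)) :
    insert s(v, u) M ∈ matchings G S := by
  rw [mem_matchings] at *
  obtain ⟨hS, hedge, hdisj⟩ := hM
  have hnew : ∀ e ∈ M, ∀ a ∈ s(v, u), a ∉ e := fun e he a ha hae => by
    have := hS e he a hae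
    rcases Sym2.mem_iff.1 ha with rfl | rfl <;> simp at this
  refine ⟨fun e he a ha => ?_, fun e he => ?_, fun e he f hf hef a hae haf => ?_⟩
  · rcases Finset.mem_insert.1 he with rfl | he
    · rcases Sym2.mem_iff.1 ha with rfl | rfl <;> assumption
    · exact Finset.mem_of_mem_erase (Finset.mem_of_mem_erase (hS e he a ha))
  · rcases Finset.mem_insert.1 he with rfl | he
    exacts [huv, hedge e he]
  · rcases Finset.mem_insert.1 he with rfl | he <;> rcases Finset.mem_insert.1 hf with rfl | hf
    exacts [hef rfl, hnew f hf a hae haf, hnew e he a haf hae, hdisj e he f hf hef a hae haf]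

theorem erase_mem_matchings {S : Finset V} {v u : V} {M : Finset (Sym2 V)}
    (hM : M ∈ matchings G S) (huv : s(v, u) ∈ M) :
    M.erase s(v, u) ∈ matchings G ((S.erase v).erase u) := by
  rw [mem_matchings] at *
  obtain ⟨hS, hedge, hdisj⟩ := hM
  refine ⟨fun e he a ha => ?_, fun e he => hedge e (Finset.mem_of_mem_erase he),
    fun e he f hf => hdisj e (Finset.mem_of_mem_erase he) f (Finset.mem_of_mem_erase hf)⟩
  obtain ⟨hne, he⟩ := Finset.mem_erase.1 he
  have hnotMem : a ∉ s(v, u) := hdisj e he _ huv hne a ha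
  simp only [Sym2.mem_iff, not_or] at hnotMem
  simp [hnotMem.1, hnotMem.2, hS e he a ha]

variable [G.LocallyFinite]

theorem sum_filter_matchings_exists_mem (lam : ℝ) {S : Finset V} {v : V} (hv : v ∈ S) :
    ∑ M ∈ matchings G S with ¬∀ e ∈ M, v ∉ e, lam ^ M.card =
      lam * ∑ u ∈ neighborsIn G S v, matchingSum G lam ((S.erase v).erase u) := by
  have hnotMem (u : V) {M} (hM : M ∈ matchings G ((S.erase v).erase u)) (w : V) : s(v, w) ∉ M :=
    notMem_of_mem_matchings_erase (matchings_mono (Finset.erase_subset _ _) hM)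
      (Sym2.mem_mk_left v w)
  simp only [matchingSum, Finset.mul_sum]
  rw [Finset.sum_sigma']
  symm
  refine Finset.sum_bij (fun x _ => insert s(v, x.1) x.2) ?_ ?_ ?_ ?_
  · rintro ⟨u, M⟩ h
    simp only [Finset.mem_sigma, mem_neighborsIn] at h
    rw [Finset.mem_filter]
    refine ⟨insert_mem_matchings hv h.1.2 h.1.1 h.2, fun hno => ?_⟩
    exact hno _ (Finset.mem_insert_self _ _) (Sym2.mem_mk_left v u)
  · rintro ⟨u, M⟩ h ⟨u', M'⟩ h' heq
    simp only [Finset.mem_sigma] at h h' heq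
    have hmem : s(v, u) ∈ insert s(v, u') M' := heq ▸ Finset.mem_insert_self _ _
    obtain rfl : u = u' :=
      Sym2.congr_right.1 ((Finset.mem_insert.1 hmem).resolve_right (hnotMem u' h'.2 u))
    rw [← Finset.erase_insert (hnotMem u h.2 u), ← Finset.erase_insert (hnotMem u h'.2 u), heq]
  · intro M hM
    simp only [Finset.mem_filter, not_forall, not_not] at hM
    obtain ⟨hM, e, he, u, rfl⟩ := hM
    obtain ⟨hS, hedge, -⟩ := mem_matchings.1 hM
    refine ⟨⟨u, M.erase s(v, u)⟩, ?_, Finset.insert_erase he⟩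
    rw [Finset.mem_sigma, mem_neighborsIn]
    exact ⟨⟨hedge _ he, hS _ he u (Sym2.mem_mk_right v u)⟩, erase_mem_matchings hM he⟩
  · rintro ⟨u, M⟩ h
    rw [Finset.card_insert_of_notMem (hnotMem u (Finset.mem_sigma.1 h).2 u), pow_succ']

theorem matchingSum_eq_add {S : Finset V} {v : V} (hv : v ∈ S) :
    matchingSum G lam S = matchingSum G lam (S.erase v) +
      lam * ∑ u ∈ neighborsIn G S v, matchingSum G lam ((S.erase v).erase u) := by
  rw [← sum_filter_matchings_exists_mem lam hv, matchingSum, matchingSum,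
    ← filter_matchings_forall_notMem S v, Finset.sum_filter_add_sum_filter_not]

theorem cavityValue_coe_finset (hlam : 0 ≤ lam) {t : ℕ} {S : Finset V} {v : V} (hv : v ∈ S)
    (ht : S.card ≤ t) :
    cavityValue G lam t S v = matchingSum G lam (S.erase v) / matchingSum G lam S := by
  induction t generalizing S v with
  | zero => simp [Finset.card_eq_zero.1 (Nat.le_zero.1 ht)] at hv
  | succ t ih =>
    have hpos : 0 < matchingSum G lam (S.erase v) := matchingSum_pos hlam _
    have hcard : (S.erase v).card ≤ t := by
      rw [Finset.card_erase_of_mem hv]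
      omega
    have hneighbor : ∀ u ∈ neighborsIn G S v, cavityValue G lam t (S \ {v}) u =
        matchingSum G lam ((S.erase v).erase u) / matchingSum G lam (S.erase v) := fun u hu => by
      obtain ⟨hadj, hu⟩ := mem_neighborsIn.1 hu
      rw [← Finset.coe_erase]
      exact ih (Finset.mem_erase.2 ⟨hadj.ne', hu⟩) hcard
    rw [cavityValue_succ, Finset.sum_congr rfl hneighbor, ← Finset.sum_div, matchingSum_eq_add hv]
    field_simp

theorem logCavityLimit_coe_finset (hlam : 0 ≤ lam) {S : Finset V} {v : V} (hv : v ∈ S) :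
    logCavityLimit G lam S v =
      Real.log (matchingSum G lam (S.erase v)) - Real.log (matchingSum G lam S) := by
  rw [← Real.log_div (matchingSum_pos hlam _).ne' (matchingSum_pos hlam _).ne']
  refine Filter.Tendsto.limUnder_eq (tendsto_const_nhds.congr' ?_)
  filter_upwards [Filter.eventually_ge_atTop S.card] with t ht
  rw [cavityValue_coe_finset hlam hv ht]

end

theorem log_matchingSum_eq_sum {V α : Type*} [LinearOrder α] {G : SimpleGraph V}
    [G.LocallyFinite] {lam : ℝ} {f : V → α} (hf : Function.Injective f) (hlam : 0 ≤ lam)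
    (S : Finset V) :
    Real.log (matchingSum G lam S) = ∑ v ∈ S, -logCavityLimit G lam {u ∈ S | f u ≤ f v} v := by
  classical
  induction S using Finset.induction_on_max_value f with
  | empty => simp [matchingSum_empty]
  | insert v S hv hmax ih =>
    have htop : {u | u ∈ insert v S ∧ f u ≤ f v} = ((insert v S : Finset V) : Set V) := by
      ext u
      refine and_iff_left_of_imp fun hu => ?_
      rcases Finset.mem_insert.1 hu with rfl | hu
      exacts [le_rfl, hmax u hu]
    have hrest : ∀ w ∈ S, {u | u ∈ insert v S ∧ f u ≤ f w} = {u | u ∈ S ∧ f u ≤ f w} := by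
      intro w hw
      ext u
      refine and_congr_left fun hu => Finset.mem_insert.trans (or_iff_right ?_)
      rintro rfl
      exact hv (hf ((hmax w hw).antisymm hu) ▸ hw)
    have hsum : ∑ w ∈ S, -logCavityLimit G lam {u | u ∈ insert v S ∧ f u ≤ f w} w =
        Real.log (matchingSum G lam S) := by
      rw [ih]
      exact Finset.sum_congr rfl fun w hw => by rw [hrest w hw]
    rw [Finset.sum_insert hv, htop, logCavityLimit_coe_finset hlam (Finset.mem_insert_self v S),
      Finset.erase_insert hv, hsum]
    ring

/-! ### The lattice and its free energy -/

section

variable {d : ℕ} {lam : ℝ}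

theorem mem_unitSteps_iff {e : Fin d → ℤ} : e ∈ unitSteps d ↔ ∑ i, |e i| = 1 := by
  simp only [unitSteps, List.mem_flatMap, List.mem_finRange, true_and, List.mem_cons,
    List.not_mem_nil, or_false]
  constructor
  · rintro ⟨i, rfl | rfl⟩ <;>
      rw [Finset.sum_eq_single i (fun j _ hj => by simp [hj]) (by simp)] <;> simp
  · intro h
    obtain ⟨i, -, hi⟩ := Finset.exists_ne_zero_of_sum_ne_zero (h.trans_ne one_ne_zero)
    have hsplit := Finset.add_sum_erase Finset.univ (fun j => |e j|) (Finset.mem_univ i)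
    have hpos : 0 < |e i| := lt_of_le_of_ne (abs_nonneg _) hi.symm
    have hrest : 0 ≤ ∑ j ∈ Finset.univ.erase i, |e j| := Finset.sum_nonneg fun _ _ => abs_nonneg _
    have hzero : ∑ j ∈ Finset.univ.erase i, |e j| = 0 := by lia
    have hone : |e i| = 1 := by lia
    rw [Finset.sum_eq_zero_iff_of_nonneg fun _ _ => abs_nonneg _] at hzero
    have he : e = Pi.single i (e i) := by
      funext j
      by_cases hj : j = i
      · rw [hj, Pi.single_eq_same]
      · rw [Pi.single_eq_of_ne hj]
        exact abs_eq_zero.1 (hzero j (by simp [hj]))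
    rcases (abs_eq zero_le_one).1 hone with h1 | h1 <;> rw [h1] at he
    exacts [⟨i, Or.inl he⟩, ⟨i, Or.inr he⟩]

theorem length_unitSteps (d : ℕ) : (unitSteps d).length = 2 * d := by
  simp [unitSteps, List.length_flatMap, mul_comm]

theorem nodup_unitSteps (d : ℕ) : (unitSteps d).Nodup := by
  rw [unitSteps, List.nodup_flatMap]
  refine ⟨fun i _ => ?_, (List.nodup_finRange d).imp fun {i j} hij => ?_⟩
  · simp
  · have h : ∀ a b : ℤ, a ≠ 0 → (Pi.single j b : Fin d → ℤ) ≠ Pi.single i a := fun a b ha h =>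
      ha (by simpa [hij] using (congrFun h i).symm)
    simp [Function.onFun, h]

theorem latticeGraph_adj_iff {v u : Fin d → ℤ} :
    (latticeGraph d).Adj v u ↔ u - v ∈ unitSteps d := by
  rw [mem_unitSteps_iff]
  simp only [latticeGraph, Pi.sub_apply, abs_sub_comm]

theorem mem_neighborSet_latticeGraph {v u : Fin d → ℤ} :
    u ∈ (unitSteps d).toFinset.image (v + ·) ↔ u ∈ (latticeGraph d).neighborSet v := by
  simp only [Finset.mem_image, List.mem_toFinset, SimpleGraph.mem_neighborSet,
    latticeGraph_adj_iff]
  exact ⟨by rintro ⟨e, he, rfl⟩; simpa using he, fun h => ⟨_, h, by simp⟩⟩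

noncomputable instance : (latticeGraph d).LocallyFinite := fun _ =>
  Fintype.ofFinset _ fun _ => mem_neighborSet_latticeGraph

theorem degree_latticeGraph_mul_le (hlam : 0 ≤ lam) (v : Fin d → ℤ) :
    (latticeGraph d).degree v * lam ≤ 2 * lam * d := by
  have hdeg : (latticeGraph d).degree v ≤ 2 * d := by
    rw [← SimpleGraph.card_neighborSet_eq_degree, Fintype.card_ofFinset, ← length_unitSteps d]
    exact Finset.card_image_le.trans (List.toFinset_card_le _)
  calc (latticeGraph d).degree v * lam ≤ (2 * d : ℕ) * lam := by gcongr
    _ = 2 * lam * d := by push_cast; ring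

/-- Translation by `w`, as an automorphism of the lattice. -/
def latticeTranslate (w : Fin d → ℤ) : latticeGraph d ≃g latticeGraph d where
  toEquiv := Equiv.addRight w
  map_rel_iff' := by simp [latticeGraph]

theorem abs_sub_le_of_edist_le {v u : Fin d → ℤ} {t : ℕ} (h : (latticeGraph d).edist v u ≤ t)
    (i : Fin d) : |u i - v i| ≤ t := by
  have hwalk : ∀ {v u : Fin d → ℤ} (p : (latticeGraph d).Walk v u), |u i - v i| ≤ p.length := by
    intro v u p
    induction p with
    | nil => simp
    | @cons v w u hadj p ih =>
      have hstep : |v i - w i| ≤ 1 :=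
        (Finset.single_le_sum (f := fun i => |v i - w i|) (fun _ _ => abs_nonneg _)
          (Finset.mem_univ i)).trans_eq hadj
      rw [SimpleGraph.Walk.length_cons]
      grind
  obtain ⟨p, hp⟩ := SimpleGraph.exists_walk_of_edist_ne_top
    (h.trans_lt (ENat.natCast_lt_top t)).ne
  rw [← hp, Nat.cast_le] at h
  exact (hwalk p).trans (mod_cast h)

theorem abs_logCavityLimit_sub_origin_le (hlam : 0 ≤ lam) {R R' : Set (Fin d → ℤ)}
    {v : Fin d → ℤ} {t : ℕ}
    (h : ∀ u, (latticeGraph d).edist v u ≤ t → (u ∈ R ↔ u - v ∈ R')) :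
    |logCavityLimit (latticeGraph d) lam R v - logCavityLimit (latticeGraph d) lam R' 0| ≤
      2 * cavityError (2 * lam * d) t := by
  have horigin : latticeTranslate (-v) v = 0 := add_neg_cancel v
  rw [← horigin, ← logCavityLimit_preimage]
  exact abs_logCavityLimit_sub_le hlam (degree_latticeGraph_mul_le hlam) fun u hu =>
    (h u hu).trans (by rw [sub_eq_add_neg]; rfl)

theorem sub_mem_cavityHalf_iff {u v : Fin d → ℤ} :
    u - v ∈ cavityHalf d ↔ toColex u ≤ toColex v := by
  have hlt : lexPrec (u - v) 0 ↔ toColex u < toColex v := by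
    refine exists_congr fun k => ?_
    simp only [Pi.sub_apply, Pi.zero_apply, sub_neg, sub_eq_zero]
    exact and_comm
  have heq : u - v = 0 ↔ toColex u = toColex v := sub_eq_zero.trans toColex_inj.symm
  exact (or_congr hlt heq).trans le_iff_lt_or_eq.symm

theorem log_partitionFunction_eq_sum (hlam : 0 ≤ lam) (S : Finset (Fin d → ℤ)) :
    Real.log (partitionFunction d lam S) =
      ∑ v ∈ S, -logCavityLimit (latticeGraph d) lam {u | u ∈ S ∧ u - v ∈ cavityHalf d} v := by
  simp only [partitionFunction_eq_matchingSum, sub_mem_cavityHalf_iff]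
  exact log_matchingSum_eq_sum toColex.injective hlam S

open Classical in
/-- The vertices of `S` within distance `t` of the complement of `S`. -/
noncomputable def nearBoundary (S : Finset (Fin d → ℤ)) (t : ℕ) : Finset (Fin d → ℤ) :=
  {v ∈ S | ∃ u ∉ S, (latticeGraph d).edist v u ≤ t}

theorem exists_mem_innerBoundary_edist_le {S : Finset (Fin d → ℤ)} {v u : Fin d → ℤ} {t : ℕ}
    (hv : v ∈ S) (hu : u ∉ S) (h : (latticeGraph d).edist v u ≤ t) :
    ∃ b ∈ innerBoundary d S, (latticeGraph d).edist v b ≤ t := by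
  classical
  obtain ⟨p, hp⟩ := SimpleGraph.exists_walk_of_edist_ne_top
    (h.trans_lt (ENat.natCast_lt_top t)).ne
  obtain ⟨a, ha, hfst, hsnd⟩ := p.exists_boundary_dart (S : Set (Fin d → ℤ)) hv hu
  refine ⟨a.fst, Finset.mem_filter.2 ⟨hfst, a.snd, a.adj, hsnd⟩, ?_⟩
  calc (latticeGraph d).edist v a.fst
      ≤ (p.takeUntil a.fst (p.dart_fst_mem_support_of_mem_darts ha)).length :=
        SimpleGraph.edist_le _
    _ ≤ p.length := mod_cast p.length_takeUntil_le_length _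
    _ ≤ t := hp.trans_le h

theorem card_nearBoundary_le (S : Finset (Fin d → ℤ)) (t : ℕ) :
    (nearBoundary S t).card ≤ (innerBoundary d S).card * (2 * t + 1) ^ d := by
  classical
  have hsub : nearBoundary S t ⊆ (innerBoundary d S).biUnion fun b =>
      Fintype.piFinset fun i => Finset.Icc (b i - t) (b i + t) := by
    intro v hv
    obtain ⟨hvS, u, huS, huv⟩ := Finset.mem_filter.1 hv
    obtain ⟨b, hb, hvb⟩ := exists_mem_innerBoundary_edist_le hvS huS huv
    refine Finset.mem_biUnion.2 ⟨b, hb, Fintype.mem_piFinset.2 fun i => ?_⟩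
    have := abs_le.1 (abs_sub_le_of_edist_le hvb i)
    exact Finset.mem_Icc.2 ⟨by lia, by lia⟩
  refine (Finset.card_le_card hsub).trans (Finset.card_biUnion_le_card_mul _ _ _ fun b _ => ?_)
  have hside : ∀ i, (b i + t + 1 - (b i - t)).toNat = 2 * t + 1 := fun i => by lia
  simp [Fintype.card_piFinset, hside]

/-- The free energy of the monomer-dimer model on `ℤ^d`, as minus the limit of `log Φ(t)`. -/
noncomputable def freeEnergy (d : ℕ) (lam : ℝ) : ℝ :=
  -logCavityLimit (latticeGraph d) lam (cavityHalf d) 0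

theorem abs_log_partitionFunction_sub_le (hlam : 0 ≤ lam) (t : ℕ) (S : Finset (Fin d → ℤ)) :
    |Real.log (partitionFunction d lam S) - S.card * freeEnergy d lam| ≤
      S.card * (2 * cavityError (2 * lam * d) t) +
        (nearBoundary S t).card * (2 * Real.log (1 + 2 * lam * d)) := by
  classical
  have hdeg := degree_latticeGraph_mul_le (d := d) hlam
  have hnear : nearBoundary S t ⊆ S := Finset.filter_subset _ S
  rw [log_partitionFunction_eq_sum hlam S, ← nsmul_eq_mul, ← Finset.sum_const,
    ← Finset.sum_sub_distrib]
  calc _ ≤ ∑ v ∈ S, (2 * cavityError (2 * lam * d) t +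
          if v ∈ nearBoundary S t then 2 * Real.log (1 + 2 * lam * d) else 0) := by
        refine (Finset.abs_sum_le_sum_abs _ _).trans (Finset.sum_le_sum fun v hv => ?_)
        rw [freeEnergy, neg_sub_neg, abs_sub_comm]
        split_ifs with h
        · have hvertex := abs_logCavityLimit_le hlam hdeg {u | u ∈ S ∧ u - v ∈ cavityHalf d} v
          have horigin := abs_logCavityLimit_le hlam hdeg (cavityHalf d) 0
          have herror := cavityError_nonneg (2 * lam * d) t
          exact (abs_sub _ _).trans (by linarith)
        · rw [add_zero]
          refine abs_logCavityLimit_sub_origin_le hlam fun u hu => and_iff_right ?_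
          by_contra huS
          exact h (Finset.mem_filter.2 ⟨hv, u, huS, hu⟩)
    _ = _ := by
        rw [Finset.sum_add_distrib, Finset.sum_const, nsmul_eq_mul, ← Finset.sum_filter,
          Finset.sum_const, nsmul_eq_mul, Finset.filter_mem_eq_inter,
          Finset.inter_eq_right.2 hnear]

theorem abs_log_partitionFunction_div_sub_le (hlam : 0 ≤ lam) (t : ℕ) {S : Finset (Fin d → ℤ)}
    (hS : S.Nonempty) :
    |Real.log (partitionFunction d lam S) / S.card - freeEnergy d lam| ≤
      2 * cavityError (2 * lam * d) t + (innerBoundary d S).card / S.card *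
        ((2 * t + 1) ^ d * (2 * Real.log (1 + 2 * lam * d))) := by
  have hcard : (0 : ℝ) < S.card := by exact_mod_cast hS.card_pos
  have hlog : 0 ≤ Real.log (1 + 2 * lam * d) := Real.log_nonneg (by
    linarith [nonneg_of_degree_mul_le hlam (degree_latticeGraph_mul_le hlam) (0 : Fin d → ℤ)])
  have hnear : ((nearBoundary S t).card : ℝ) ≤ (innerBoundary d S).card * (2 * t + 1) ^ d := by
    exact_mod_cast card_nearBoundary_le S t
  rw [div_sub' hcard.ne', abs_div, abs_of_pos hcard, div_le_iff₀ hcard]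
  calc _ ≤ _ := abs_log_partitionFunction_sub_le hlam t S
    _ ≤ S.card * (2 * cavityError (2 * lam * d) t) + (innerBoundary d S).card * (2 * t + 1) ^ d *
          (2 * Real.log (1 + 2 * lam * d)) := by gcongr
    _ = _ := by field_simp

theorem isFreeEnergy_freeEnergy (hlam : 0 ≤ lam) : IsFreeEnergy d lam (freeEnergy d lam) := by
  intro S hS
  have hD := nonneg_of_degree_mul_le hlam (degree_latticeGraph_mul_le hlam) (0 : Fin d → ℤ)
  refine tendsto_iff_dist_tendsto_zero.2 (tendsto_order.2
    ⟨fun _ h => Filter.Eventually.of_forall fun _ => h.trans_le dist_nonneg, fun ε hε => ?_⟩)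
  obtain ⟨t, ht⟩ := ((tendsto_cavityError hD).eventually_lt_const (half_pos hε)).exists
  have hlim := (hS.2.mul_const ((2 * t + 1 : ℝ) ^ d * (2 * Real.log (1 + 2 * lam * d)))).const_add
    (2 * cavityError (2 * lam * d) t)
  rw [zero_mul, add_zero] at hlim
  filter_upwards [hlim.eventually_lt_const (show _ < ε by linarith)] with n hn
  exact (abs_log_partitionFunction_div_sub_le hlam t (hS.1 n)).trans_lt hn

end

/-! ### Boxes and the surface pressure -/

section

variable {d : ℕ} {lam : ℝ}

/-- The part of `cavityHalf d` on the near side of a face at distance `k` from the origin. A face of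
a box is given by its direction `f.1` and the sign `f.2` of its outer normal vector. -/
def faceRegion (f : Fin d × ℤˣ) (k : ℕ) : Set (Fin d → ℤ) :=
  {u | u ∈ cavityHalf d ∧ f.2 * u f.1 ≤ (k : ℤ)}

theorem faceRegion_one (j : Fin d) (k : ℕ) : faceRegion (j, 1) k = cavityUpper d j k := by
  simp only [faceRegion, cavityUpper, Units.val_one, one_mul]

theorem faceRegion_neg_one (j : Fin d) (k : ℕ) : faceRegion (j, -1) k = cavityLower d j k := by
  simp only [faceRegion, cavityLower, Units.val_neg, Units.val_one, neg_one_mul, neg_le]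

/-- The contribution to the surface pressure of a vertex at distance `k` from the face `f`. -/
noncomputable def faceExcess (lam : ℝ) (f : Fin d × ℤˣ) (k : ℕ) : ℝ :=
  logCavityLimit (latticeGraph d) lam (cavityHalf d) 0 -
    logCavityLimit (latticeGraph d) lam (faceRegion f k) 0

theorem units_mul_le_abs (σ : ℤˣ) (x : ℤ) : σ * x ≤ |x| := by
  rcases Int.units_eq_one_or σ with rfl | rfl
  · simpa using le_abs_self x
  · simpa using neg_le_abs x

theorem mem_faceRegion_iff_of_edist_le (f : Fin d × ℤˣ) {k : ℕ} {u : Fin d → ℤ}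
    (h : (latticeGraph d).edist 0 u ≤ k) : u ∈ faceRegion f k ↔ u ∈ cavityHalf d :=
  and_iff_left ((units_mul_le_abs f.2 _).trans (by simpa using abs_sub_le_of_edist_le h f.1))

theorem abs_faceExcess_le (hlam : 0 ≤ lam) (f : Fin d × ℤˣ) (k : ℕ) :
    |faceExcess lam f k| ≤ 2 * cavityError (2 * lam * d) k :=
  abs_logCavityLimit_sub_le hlam (degree_latticeGraph_mul_le hlam) fun _ hu =>
    (mem_faceRegion_iff_of_edist_le f hu).symm

theorem exists_cavityError_le_mul_pow {D : ℝ} (hD : 0 ≤ D) :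
    ∃ K q : ℝ, 0 < q ∧ q < 1 ∧ ∀ n, cavityError D n ≤ K * q ^ (2 * n) := by
  set x₀ := 1 / (2 * √(1 + D)) with hx₀_def
  have hx₀ : 0 < x₀ := by positivity
  refine ⟨4 / (1 - Real.exp (-(2 * x₀))) ^ 2, Real.exp (-x₀), Real.exp_pos _,
    Real.exp_lt_one_iff.2 (neg_lt_zero.2 hx₀), fun n => ?_⟩
  have hn : x₀ ≤ (n + 1) / (2 * √(1 + D)) := by
    rw [hx₀_def]
    gcongr
    linarith [n.cast_nonneg (α := ℝ)]
  refine (cavityError_le_mul_exp hx₀ hn).trans ?_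
  have hexp : ((2 * n : ℕ) : ℝ) * -x₀ = -(n / √(1 + D)) := by
    rw [hx₀_def]
    push_cast
    field_simp
  rw [← Real.exp_nat_mul, hexp]
  gcongr
  linarith

theorem summable_cavityError {D : ℝ} (hD : 0 ≤ D) : Summable (cavityError D) := by
  obtain ⟨K, q, hq, hq1, h⟩ := exists_cavityError_le_mul_pow hD
  refine Summable.of_nonneg_of_le (cavityError_nonneg D) h ?_
  simp only [pow_mul]
  exact (summable_geometric_of_lt_one (sq_nonneg q) (pow_lt_one₀ hq.le hq1 two_ne_zero)).mul_left K

theorem summable_faceExcess (hlam : 0 ≤ lam) (f : Fin d × ℤˣ) : Summable (faceExcess lam f) := by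
  have hD := nonneg_of_degree_mul_le hlam (degree_latticeGraph_mul_le hlam) (0 : Fin d → ℤ)
  exact ((summable_cavityError hD).mul_left 2).of_norm_bounded (abs_faceExcess_le hlam f)

/-- The box with half-widths `N`. -/
noncomputable def natBox (N : Fin d → ℕ) : Finset (Fin d → ℤ) :=
  Fintype.piFinset fun i => Finset.Icc (-(N i : ℤ)) (N i)

/-- The distance of `v` from the face `f` of the box with half-widths `N`; it is truncated to `0`
if `v` lies beyond that face. -/
def faceDist (N : Fin d → ℕ) (f : Fin d × ℤˣ) (v : Fin d → ℤ) : ℕ :=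
  ((N f.1 : ℤ) - f.2 * v f.1).toNat

theorem mem_natBox {N : Fin d → ℕ} {v : Fin d → ℤ} :
    v ∈ natBox N ↔ ∀ f : Fin d × ℤˣ, f.2 * v f.1 ≤ N f.1 := by
  simp only [natBox, Fintype.mem_piFinset, Finset.mem_Icc]
  refine ⟨fun h f => (units_mul_le_abs f.2 _).trans (abs_le.2 (h f.1)), fun h i => ?_⟩
  have hlow : -v i ≤ N i := by simpa using h (i, -1)
  exact ⟨by lia, by simpa using h (i, 1)⟩

theorem natCast_faceDist {N : Fin d → ℕ} {v : Fin d → ℤ} (hv : v ∈ natBox N) (f : Fin d × ℤˣ) :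
    (faceDist N f v : ℤ) = N f.1 - f.2 * v f.1 :=
  Int.toNat_of_nonneg (sub_nonneg.2 (mem_natBox.1 hv f))

theorem mem_natBox_iff_of_edist_le {N : Fin d → ℕ} {v : Fin d → ℤ} (hv : v ∈ natBox N)
    {f : Fin d × ℤˣ} {n : ℕ} (h : ∀ g ≠ f, n ≤ faceDist N g v) {u : Fin d → ℤ}
    (hu : (latticeGraph d).edist v u ≤ n) :
    u ∈ natBox N ↔ f.2 * (u - v) f.1 ≤ (faceDist N f v : ℤ) := by
  rw [natCast_faceDist hv, Pi.sub_apply, mul_sub, sub_le_sub_iff_right, mem_natBox]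
  refine ⟨fun hbox => hbox f, fun hf g => ?_⟩
  by_cases hg : g = f
  · exact hg ▸ hf
  · have hdist : (n : ℤ) ≤ faceDist N g v := mod_cast h g hg
    have hmove := (units_mul_le_abs g.2 _).trans (abs_sub_le_of_edist_le hu g.1)
    rw [natCast_faceDist hv] at hdist
    linarith

theorem abs_logCavityLimit_natBox_sub_faceRegion_le (hlam : 0 ≤ lam) {N : Fin d → ℕ}
    {v : Fin d → ℤ} (hv : v ∈ natBox N) {f : Fin d × ℤˣ} {n : ℕ}
    (h : ∀ g ≠ f, n ≤ faceDist N g v) :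
    |logCavityLimit (latticeGraph d) lam {u | u ∈ natBox N ∧ u - v ∈ cavityHalf d} v -
      logCavityLimit (latticeGraph d) lam (faceRegion f (faceDist N f v)) 0| ≤
      2 * cavityError (2 * lam * d) n :=
  abs_logCavityLimit_sub_origin_le hlam fun _ hu =>
    (and_congr_left' (mem_natBox_iff_of_edist_le hv h hu)).trans and_comm

theorem abs_logCavityLimit_natBox_sub_le (hd : 0 < d) (hlam : 0 ≤ lam) {K q : ℝ} (hq : 0 < q)
    (hq1 : q < 1) (hKq : ∀ n, cavityError (2 * lam * d) n ≤ K * q ^ (2 * n)) {N : Fin d → ℕ}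
    {v : Fin d → ℤ} (hv : v ∈ natBox N) :
    |-logCavityLimit (latticeGraph d) lam {u | u ∈ natBox N ∧ u - v ∈ cavityHalf d} v -
        freeEnergy d lam - ∑ f, faceExcess lam f (faceDist N f v)| ≤
      4 * K * ∑ f, ∑ g ∈ Finset.univ.erase f, q ^ (faceDist N f v + faceDist N g v) := by
  have hK : 0 ≤ K := by simpa using (cavityError_nonneg _ 0).trans (hKq 0)
  obtain ⟨f, -, hf⟩ := Finset.exists_min_image Finset.univ (fun f => faceDist N f v)
    ⟨(⟨0, hd⟩, 1), Finset.mem_univ _⟩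
  obtain ⟨g, hg, hmin⟩ := Finset.exists_min_image (Finset.univ.erase f) (fun f => faceDist N f v)
    ⟨(f.1, -f.2), by simp [Prod.ext_iff]⟩
  have hpow : ∀ g, cavityError (2 * lam * d) (faceDist N g v) ≤
      K * q ^ (faceDist N f v + faceDist N g v) := fun g =>
    (hKq _).trans (mul_le_mul_of_nonneg_left
      (pow_le_pow_of_le_one hq.le hq1.le (by linarith [hf g (Finset.mem_univ g)])) hK)
  set T := ∑ g ∈ Finset.univ.erase f, q ^ (faceDist N f v + faceDist N g v) with hT
  have hnearest : |logCavityLimit (latticeGraph d) lam {u | u ∈ natBox N ∧ u - v ∈ cavityHalf d} v -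
      logCavityLimit (latticeGraph d) lam (faceRegion f (faceDist N f v)) 0| ≤ 2 * (K * T) := by
    refine (abs_logCavityLimit_natBox_sub_faceRegion_le hlam hv fun g' hg' =>
      hmin g' (by simpa using hg')).trans ?_
    have hle : q ^ (faceDist N f v + faceDist N g v) ≤ T :=
      Finset.single_le_sum (f := fun g => q ^ (faceDist N f v + faceDist N g v))
        (fun _ _ => (pow_pos hq _).le) hg
    linarith [hpow g, mul_le_mul_of_nonneg_left hle hK]
  have hothers : |∑ g ∈ Finset.univ.erase f, faceExcess lam g (faceDist N g v)| ≤ 2 * (K * T) := by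
    rw [hT, Finset.mul_sum, Finset.mul_sum]
    refine (Finset.abs_sum_le_sum_abs _ _).trans (Finset.sum_le_sum fun g _ => ?_)
    linarith [hpow g, abs_faceExcess_le hlam g (faceDist N g v)]
  have hT_le : T ≤ ∑ f, ∑ g ∈ Finset.univ.erase f, q ^ (faceDist N f v + faceDist N g v) :=
    Finset.single_le_sum (f := fun f => ∑ g ∈ Finset.univ.erase f,
      q ^ (faceDist N f v + faceDist N g v))
      (fun _ _ => Finset.sum_nonneg fun _ _ => (pow_pos hq _).le) (Finset.mem_univ f)
  rw [← Finset.add_sum_erase _ _ (Finset.mem_univ f), faceExcess, freeEnergy]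
  rw [abs_le] at hnearest hothers ⊢
  have hKT := mul_le_mul_of_nonneg_left hT_le hK
  constructor <;> linarith

end

section

open Filter

variable {d : ℕ} {lam : ℝ}

theorem sum_piFinset_prod {ι α : Type*} [Fintype ι] [DecidableEq ι] (t : ι → Finset α)
    (s : Finset ι) (F : ι → α → ℝ) :
    ∑ v ∈ Fintype.piFinset t, ∏ i ∈ s, F i (v i) =
      (∏ i ∈ sᶜ, ((t i).card : ℝ)) * ∏ i ∈ s, ∑ x ∈ t i, F i x := by
  calc _ = ∑ v ∈ Fintype.piFinset t, ∏ i, if i ∈ s then F i (v i) else 1 := by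
        simp only [Finset.prod_ite_mem, Finset.univ_inter]
    _ = ∏ i, ∑ x ∈ t i, if i ∈ s then F i x else 1 :=
        (Finset.prod_univ_sum t fun i x => if i ∈ s then F i x else 1).symm
    _ = _ := by
        rw [← Finset.prod_compl_mul_prod s]
        congr 1 <;> refine Finset.prod_congr rfl fun i hi => ?_
        · simp [Finset.mem_compl.1 hi]
        · simp [hi]

theorem card_Icc_neg (n : ℕ) : ((Finset.Icc (-(n : ℤ)) n).card : ℝ) = 2 * n + 1 := by
  have hside : ((n : ℤ) + 1 - -(n : ℤ)).toNat = 2 * n + 1 := by lia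
  rw [Int.card_Icc, hside]
  push_cast
  rfl

/-- The number of vertices on a face orthogonal to `j` of the box with half-widths `N`. -/
noncomputable def faceArea (N : Fin d → ℕ) (j : Fin d) : ℝ :=
  ∏ i ∈ Finset.univ.erase j, (2 * (N i : ℝ) + 1)

theorem faceArea_nonneg (N : Fin d → ℕ) (j : Fin d) : 0 ≤ faceArea N j :=
  Finset.prod_nonneg fun _ _ => by positivity

theorem card_natBox (N : Fin d → ℕ) (j : Fin d) :
    ((natBox N).card : ℝ) = faceArea N j * (2 * N j + 1) := by
  rw [natBox, Fintype.card_piFinset, Nat.cast_prod, faceArea,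
    Finset.prod_erase_mul _ _ (Finset.mem_univ j)]
  exact Finset.prod_congr rfl fun i _ => card_Icc_neg _

theorem sum_Icc_toNat_sub_units_mul (σ : ℤˣ) (n : ℕ) (F : ℕ → ℝ) :
    ∑ x ∈ Finset.Icc (-(n : ℤ)) n, F ((n : ℤ) - σ * x).toNat =
      ∑ k ∈ Finset.range (2 * n + 1), F k := by
  refine Finset.sum_nbij' (fun x => ((n : ℤ) - σ * x).toNat) (fun k => σ * ((n : ℤ) - k))
    ?_ ?_ ?_ ?_ fun _ _ => rfl <;>
  · simp only [Finset.mem_Icc, Finset.mem_range]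
    rcases Int.units_eq_one_or σ with rfl | rfl <;>
    · push_cast
      lia

theorem sum_natBox_faceDist (N : Fin d → ℕ) (f : Fin d × ℤˣ) (F : ℕ → ℝ) :
    ∑ v ∈ natBox N, F (faceDist N f v) =
      faceArea N f.1 * ∑ k ∈ Finset.range (2 * N f.1 + 1), F k := by
  have h := sum_piFinset_prod (fun i => Finset.Icc (-(N i : ℤ)) (N i)) {f.1}
    fun i x => F ((N i : ℤ) - f.2 * x).toNat
  simp only [Finset.prod_singleton, sum_Icc_toNat_sub_units_mul, card_Icc_neg,
    Finset.compl_singleton] at h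
  exact h

theorem sum_natBox_faceDist_mul (N : Fin d → ℕ) {f g : Fin d × ℤˣ} (hfg : f.1 ≠ g.1)
    (F G : ℕ → ℝ) :
    (∑ v ∈ natBox N, F (faceDist N f v) * G (faceDist N g v)) * (2 * N g.1 + 1) =
      faceArea N f.1 * ((∑ k ∈ Finset.range (2 * N f.1 + 1), F k) *
        ∑ k ∈ Finset.range (2 * N g.1 + 1), G k) := by
  have h := sum_piFinset_prod (fun i => Finset.Icc (-(N i : ℤ)) (N i)) {f.1, g.1} fun i x =>
    if i = f.1 then F ((N i : ℤ) - f.2 * x).toNat else G ((N i : ℤ) - g.2 * x).toNat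
  simp only [Finset.prod_pair hfg, if_true, if_neg hfg.symm, sum_Icc_toNat_sub_units_mul,
    card_Icc_neg] at h
  have hcompl : ({f.1, g.1} : Finset (Fin d))ᶜ = (Finset.univ.erase f.1).erase g.1 := by
    rw [Finset.insert_eq, Finset.compl_union, Finset.compl_singleton, Finset.compl_singleton,
      Finset.inter_erase, Finset.inter_univ]
  rw [hcompl] at h
  rw [faceArea, ← Finset.prod_erase_mul _ _ (Finset.mem_erase.2 ⟨hfg.symm, Finset.mem_univ g.1⟩),
    mul_right_comm, ← h]
  rfl

theorem sum_range_pow_le {q : ℝ} (hq : 0 ≤ q) (hq1 : q < 1) (n : ℕ) :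
    ∑ k ∈ Finset.range n, q ^ k ≤ (1 - q)⁻¹ := by
  rw [← tsum_geometric_of_lt_one hq hq1]
  exact (summable_geometric_of_lt_one hq hq1).sum_le_tsum _ fun _ _ => pow_nonneg hq _

theorem faceDist_add_faceDist {N : Fin d → ℕ} {f g : Fin d × ℤˣ} (hfg : g ≠ f) (h : f.1 = g.1)
    {v : Fin d → ℤ} (hv : v ∈ natBox N) : faceDist N f v + faceDist N g v = 2 * N f.1 := by
  have hsign : g.2 = -f.2 := Int.units_ne_iff_eq_neg.1 fun h2 => hfg (Prod.ext h.symm h2)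
  have hf := natCast_faceDist hv f
  have hg := natCast_faceDist hv g
  rw [hsign, ← h] at hg
  push_cast at hg
  lia

theorem sum_natBox_pow_of_opposite {N : Fin d → ℕ} {f g : Fin d × ℤˣ} (hfg : g ≠ f)
    (h : f.1 = g.1) (q : ℝ) :
    ∑ v ∈ natBox N, q ^ (faceDist N f v + faceDist N g v) =
      faceArea N f.1 * ((2 * N f.1 + 1) * q ^ (2 * N f.1)) := by
  rw [Finset.sum_congr rfl fun v hv => by rw [faceDist_add_faceDist hfg h hv],
    Finset.sum_const, nsmul_eq_mul, card_natBox N f.1, mul_assoc]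

theorem sum_natBox_pow_le_of_ne {N : Fin d → ℕ} {f g : Fin d × ℤˣ} (h : f.1 ≠ g.1) {q : ℝ}
    (hq : 0 ≤ q) (hq1 : q < 1) :
    ∑ v ∈ natBox N, q ^ (faceDist N f v + faceDist N g v) ≤
      faceArea N f.1 * ((1 - q)⁻¹ ^ 2 / (2 * N g.1 + 1)) := by
  simp only [pow_add]
  rw [← mul_div_assoc, le_div_iff₀ (by positivity), sum_natBox_faceDist_mul N h (q ^ ·) (q ^ ·),
    sq]
  have hgeom := sum_range_pow_le hq hq1
  exact mul_le_mul_of_nonneg_left (mul_le_mul (hgeom _) (hgeom _)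
    (Finset.sum_nonneg fun _ _ => pow_nonneg hq _) (inv_nonneg.2 (sub_nonneg.2 hq1.le)))
    (faceArea_nonneg N f.1)

theorem abs_log_partitionFunction_natBox_sub_le (hd : 0 < d) (hlam : 0 ≤ lam) {K q : ℝ}
    (hq : 0 < q) (hq1 : q < 1) (hKq : ∀ n, cavityError (2 * lam * d) n ≤ K * q ^ (2 * n))
    (N : Fin d → ℕ) :
    |Real.log (partitionFunction d lam (natBox N)) - (natBox N).card * freeEnergy d lam -
        ∑ f, faceArea N f.1 * ∑ k ∈ Finset.range (2 * N f.1 + 1), faceExcess lam f k| ≤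
      4 * K * ∑ f, ∑ g ∈ Finset.univ.erase f,
        ∑ v ∈ natBox N, q ^ (faceDist N f v + faceDist N g v) := by
  rw [log_partitionFunction_eq_sum hlam, ← nsmul_eq_mul, ← Finset.sum_const,
    ← Finset.sum_sub_distrib]
  simp only [← sum_natBox_faceDist]
  rw [Finset.sum_comm, ← Finset.sum_sub_distrib]
  refine (Finset.abs_sum_le_sum_abs _ _).trans ((Finset.sum_le_sum fun v hv =>
    abs_logCavityLimit_natBox_sub_le hd hlam hq hq1 hKq hv).trans_eq ?_)
  rw [← Finset.mul_sum, Finset.sum_comm]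
  exact congrArg _ (Finset.sum_congr rfl fun f _ => Finset.sum_comm)

/-- The half-widths of the lattice box `rectBox a n`. -/
noncomputable def halfWidth (a : Fin d → ℝ) (n : ℕ) (i : Fin d) : ℕ := ⌊a i * n⌋₊

theorem rectBox_eq_natBox {a : Fin d → ℝ} (ha : ∀ i, 0 ≤ a i) (n : ℕ) :
    rectBox a n = natBox (halfWidth a n) := by
  have h : ∀ i, ⌊a i * n⌋ = (halfWidth a n i : ℤ) := fun i =>
    (Int.natCast_floor_eq_floor (mul_nonneg (ha i) n.cast_nonneg)).symm
  simp only [rectBox, natBox, h]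

theorem tendsto_halfWidth {a : Fin d → ℝ} {i : Fin d} (ha : 0 < a i) :
    Tendsto (fun n => halfWidth a n i) atTop atTop :=
  tendsto_nat_floor_atTop.comp (tendsto_natCast_atTop_atTop.const_mul_atTop ha)

theorem tendsto_two_mul_halfWidth_add_one {a : Fin d → ℝ} {i : Fin d} (ha : 0 < a i) :
    Tendsto (fun n => 2 * halfWidth a n i + 1) atTop atTop :=
  tendsto_atTop_mono (fun _ => by lia) (tendsto_halfWidth ha)

theorem tendsto_faceArea_div {a : Fin d → ℝ} (ha : ∀ i, 0 ≤ a i) (j : Fin d) :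
    Tendsto (fun n : ℕ => faceArea (halfWidth a n) j / (n : ℝ) ^ (d - 1)) atTop
      (𝓝 (∏ i ∈ Finset.univ.erase j, (2 * a i))) := by
  have hwidth : ∀ i, Tendsto (fun n : ℕ => (2 * (halfWidth a n i : ℝ) + 1) / n) atTop
      (𝓝 (2 * a i)) := fun i => by
    have hfloor := (tendsto_nat_floor_mul_div_atTop (ha i)).comp
      (tendsto_natCast_atTop_atTop (R := ℝ))
    have h := (hfloor.const_mul 2).add tendsto_one_div_atTop_nhds_zero_nat
    rw [add_zero] at h
    refine h.congr fun n => ?_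
    simp only [Function.comp_apply, halfWidth]
    ring
  refine (tendsto_finsetProd (Finset.univ.erase j) fun i _ => hwidth i).congr fun n => ?_
  rw [Finset.prod_div_distrib, Finset.prod_const, Finset.card_erase_of_mem (Finset.mem_univ j),
    Finset.card_univ, Fintype.card_fin, faceArea]

theorem tendsto_sum_natBox_pow_div {a : Fin d → ℝ} (ha : ∀ i, 0 < a i) {q : ℝ} (hq : 0 < q)
    (hq1 : q < 1) {f g : Fin d × ℤˣ} (hfg : g ≠ f) :
    Tendsto (fun n : ℕ => (∑ v ∈ natBox (halfWidth a n),
      q ^ (faceDist (halfWidth a n) f v + faceDist (halfWidth a n) g v)) / (n : ℝ) ^ (d - 1))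
      atTop (𝓝 0) := by
  have harea := tendsto_faceArea_div (fun i => (ha i).le) f.1
  have hwidth := fun i => tendsto_two_mul_halfWidth_add_one (ha i)
  by_cases h : f.1 = g.1
  · have hpow := ((tendsto_self_mul_const_pow_of_lt_one hq.le hq1).comp (hwidth f.1)).const_mul q⁻¹
    have hlim := harea.mul hpow
    rw [mul_zero, mul_zero] at hlim
    refine hlim.congr fun n => ?_
    rw [sum_natBox_pow_of_opposite hfg h, Function.comp_apply, pow_succ]
    push_cast
    field_simp
  · have hinv := (tendsto_natCast_atTop_atTop.comp (hwidth g.1)).const_div_atTop ((1 - q)⁻¹ ^ 2)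
    have hlim := harea.mul hinv
    rw [mul_zero] at hlim
    refine squeeze_zero (fun n => by positivity) (fun n => ?_) hlim
    rw [div_mul_eq_mul_div]
    gcongr
    simpa using sum_natBox_pow_le_of_ne h hq.le hq1

theorem tendsto_sum_faceExcess_div (hlam : 0 ≤ lam) {a : Fin d → ℝ} (ha : ∀ i, 0 < a i) :
    Tendsto (fun n : ℕ => (∑ f, faceArea (halfWidth a n) f.1 *
        ∑ k ∈ Finset.range (2 * halfWidth a n f.1 + 1), faceExcess lam f k) / (n : ℝ) ^ (d - 1))
      atTop (𝓝 (∑ f : Fin d × ℤˣ,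
        (∏ i ∈ Finset.univ.erase f.1, (2 * a i)) * ∑' k, faceExcess lam f k)) := by
  simp only [Finset.sum_div, mul_div_right_comm]
  exact tendsto_finsetSum _ fun f _ => (tendsto_faceArea_div (fun i => (ha i).le) f.1).mul
    ((summable_faceExcess hlam f).hasSum.tendsto_sum_nat.comp
      (tendsto_two_mul_halfWidth_add_one (ha f.1)))

/-- The surface pressure of the monomer-dimer model for the shape `a`: every vertex at distance `k`
from a face `f` contributes `faceExcess lam f k`. -/
noncomputable def surfacePressure (lam : ℝ) (a : Fin d → ℝ) : ℝ :=
  (∑ f : Fin d × ℤˣ, (∏ i ∈ Finset.univ.erase f.1, (2 * a i)) * ∑' k, faceExcess lam f k) /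
    surfaceArea a

theorem isSurfacePressure_surfacePressure (hd : 0 < d) (hlam : 0 ≤ lam) {a : Fin d → ℝ}
    (ha : ∀ i, 0 < a i) :
    IsSurfacePressure d lam (freeEnergy d lam) a (surfacePressure lam a) := by
  have hD := nonneg_of_degree_mul_le hlam (degree_latticeGraph_mul_le hlam) (0 : Fin d → ℤ)
  obtain ⟨K, q, hq, hq1, hKq⟩ := exists_cavityError_le_mul_pow hD
  have herror : Tendsto (fun n : ℕ => (4 * K * ∑ f, ∑ g ∈ Finset.univ.erase f,
      ∑ v ∈ natBox (halfWidth a n),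
        q ^ (faceDist (halfWidth a n) f v + faceDist (halfWidth a n) g v)) / (n : ℝ) ^ (d - 1))
      atTop (𝓝 0) := by
    have h := (tendsto_finsetSum Finset.univ fun f _ => tendsto_finsetSum (Finset.univ.erase f)
      fun g hg => tendsto_sum_natBox_pow_div ha hq hq1 (Finset.ne_of_mem_erase hg)).const_mul
        (4 * K)
    simpa only [Finset.sum_const_zero, mul_zero, mul_div_assoc, Finset.sum_div] using h
  have hdiff : Tendsto (fun n : ℕ => (Real.log (partitionFunction d lam (natBox (halfWidth a n))) -
      (natBox (halfWidth a n)).card * freeEnergy d lam - ∑ f, faceArea (halfWidth a n) f.1 *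
        ∑ k ∈ Finset.range (2 * halfWidth a n f.1 + 1), faceExcess lam f k) / (n : ℝ) ^ (d - 1))
      atTop (𝓝 0) := by
    refine squeeze_zero_norm (fun n => ?_) herror
    rw [norm_div, norm_pow, Real.norm_natCast, Real.norm_eq_abs]
    gcongr
    exact abs_log_partitionFunction_natBox_sub_le hd hlam hq hq1 hKq (halfWidth a n)
  have hsum := (hdiff.add (tendsto_sum_faceExcess_div hlam ha)).div_const (surfaceArea a)
  rw [zero_add] at hsum
  refine hsum.congr fun n => ?_
  rw [rectBox_eq_natBox fun i => (ha i).le, sub_div, sub_add_cancel, div_div,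
    mul_comm (surfaceArea a)]

end

/-! ### Values and step counts of the algorithm -/

section

namespace Timed

variable {α β : Type}

@[simp] theorem val_pure (x : α) : (pure x : Timed α).val = x := rfl

@[simp] theorem steps_pure (x : α) : (pure x : Timed α).steps = 0 := rfl

@[simp] theorem val_bind (m : Timed α) (f : α → Timed β) : (m >>= f).val = (f m.val).val := rfl

@[simp] theorem steps_bind (m : Timed α) (f : α → Timed β) :
    (m >>= f).steps = m.steps + (f m.val).steps := rfl

@[simp] theorem val_instr (c : ℕ) (x : α) : (instr c x).val = x := rfl

@[simp] theorem steps_instr (c : ℕ) (x : α) : (instr c x).steps = c := rfl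

theorem val_foldlM_add {f : ℝ → α → Timed ℝ} {g : α → ℝ} (h : ∀ s a, (f s a).val = s + g a)
    (l : List α) (b : ℝ) : (l.foldlM f b).val = b + (l.map g).sum := by
  induction l generalizing b with
  | nil => simp
  | cons a l ih =>
    rw [List.foldlM_cons, val_bind, ih, h, List.map_cons, List.sum_cons, add_assoc]

theorem steps_foldlM_le {f : β → α → Timed β} {c : ℕ} (h : ∀ b a, (f b a).steps ≤ c) (l : List α)
    (b : β) : (l.foldlM f b).steps ≤ l.length * c := by
  induction l generalizing b with
  | nil => simp
  | cons a l ih =>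
    rw [List.foldlM_cons, steps_bind, List.length_cons, add_mul, one_mul, add_comm]
    exact Nat.add_le_add (ih _) (h b a)

theorem inRegion_and_not_inList_iff {d : ℕ} {R : Set (Fin d → ℤ)} {Y : List (Fin d → ℤ)}
    {u : Fin d → ℤ} :
    ((inRegion R u).val && !(inList Y u).val) = true ↔ u ∈ R \ {x | x ∈ Y} := by
  simp [inRegion, inList]

theorem steps_inRegion {d : ℕ} (R : Set (Fin d → ℤ)) (u : Fin d → ℤ) :
    (inRegion R u).steps = 2 * d + 1 := rfl

theorem steps_inList {d : ℕ} (Y : List (Fin d → ℤ)) (u : Fin d → ℤ) :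
    (inList Y u).steps = Y.length * (d + 1) + 1 := rfl

end Timed

variable {d : ℕ} {lam : ℝ}

theorem sum_neighborsIn_latticeGraph (R : Set (Fin d → ℤ)) [DecidablePred (· ∈ R)]
    (v : Fin d → ℤ) (F : (Fin d → ℤ) → ℝ) :
    ∑ u ∈ neighborsIn (latticeGraph d) R v, F u =
      ((unitSteps d).map fun e => if v + e ∈ R then F (v + e) else 0).sum := by
  rw [← List.sum_toFinset _ (nodup_unitSteps d), ← Finset.sum_filter]
  refine Finset.sum_nbij' (· - v) (v + ·) ?_ ?_ ?_ ?_ ?_ <;>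
    simp +contextual [mem_neighborsIn, latticeGraph_adj_iff]

open Classical in
theorem val_cavity (lam : ℝ) (R : Set (Fin d → ℤ)) (t : ℕ) (X : List (Fin d → ℤ))
    (v : Fin d → ℤ) :
    (cavity lam R 1 t X v).val = cavityValue (latticeGraph d) lam t (R \ {x | x ∈ X}) v := by
  induction t generalizing X v with
  | zero => rfl
  | succ t ih =>
    have hR : (R \ {x | x ∈ X}) \ {v} = R \ {x | x ∈ v :: X} := by
      ext u
      simp [and_assoc, and_comm]
    have hv : neighborsIn (latticeGraph d) (R \ {x | x ∈ X}) v =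
        neighborsIn (latticeGraph d) (R \ {x | x ∈ v :: X}) v := by
      ext u
      rw [mem_neighborsIn, mem_neighborsIn, ← hR]
      exact and_congr_right fun h => (and_iff_left h.ne').symm
    rw [cavity, cavityValue_succ, hv, hR, sum_neighborsIn_latticeGraph]
    simp only [Timed.val_bind, Timed.val_instr, Timed.mul, Timed.add, Timed.div]
    rw [Timed.val_foldlM_add (g := fun e => if v + e ∈ R \ {x | x ∈ v :: X} then
      cavityValue (latticeGraph d) lam t (R \ {x | x ∈ v :: X}) (v + e) else 0), zero_add]
    intro s e
    simp only [Timed.tick, Timed.translate, Timed.val_bind, Timed.val_instr,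
      Timed.inRegion_and_not_inList_iff]
    split_ifs
    · rw [Timed.val_bind, ih, Timed.val_instr]
    · rw [Timed.val_pure, add_zero]

theorem steps_cavity_succ_le {R : Set (Fin d → ℤ)} {b : ℝ} {t T : ℕ} {X : List (Fin d → ℤ)}
    {v : Fin d → ℤ} (hT : ∀ u, (cavity lam R b t (v :: X) u).steps ≤ T) :
    (cavity lam R b (t + 1) X v).steps ≤
      4 + 2 * d * (3 * d + 4 + (X.length + 1) * (d + 1) + T) := by
  have hloop := Timed.steps_foldlM_le (α := Fin d → ℤ) (f := fun (s : ℝ) e => do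
    Timed.tick
    let u ← Timed.translate v e
    let inside ← Timed.inRegion R u
    let removed ← Timed.inList (v :: X) u
    if inside && !removed then
      let x ← cavity lam R b t (v :: X) u
      Timed.add s x
    else
      pure s) (c := 3 * d + 4 + (X.length + 1) * (d + 1) + T) (fun s e => by
      have hrec := hT (v + e)
      simp only [Timed.tick, Timed.translate, Timed.add, Timed.steps_bind, Timed.val_instr,
        Timed.steps_instr, Timed.steps_inRegion, Timed.steps_inList, List.length_cons]
      split_ifs
      · rw [Timed.steps_bind, Timed.steps_instr]
        lia
      · rw [Timed.steps_pure]
        lia) (unitSteps d) 0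
  rw [length_unitSteps] at hloop
  rw [cavity]
  simp only [Timed.mul, Timed.add, Timed.div, Timed.steps_bind, Timed.val_instr,
    Timed.steps_instr] at hloop ⊢
  lia

theorem steps_cavity_le (lam : ℝ) (R : Set (Fin d → ℤ)) (b : ℝ) {n t : ℕ} {X : List (Fin d → ℤ)}
    (v : Fin d → ℤ) (h : X.length + t ≤ n) :
    (cavity lam R b t X v).steps ≤ (4 + 2 * d * (3 * d + 4 + n * (d + 1))) * (2 * d + 1) ^ t := by
  set c := 4 + 2 * d * (3 * d + 4 + n * (d + 1)) with hc
  induction t generalizing X v with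
  | zero =>
    rw [pow_zero, mul_one, cavity, Timed.steps_instr]
    lia
  | succ t ih =>
    have hlen : X.length + 1 ≤ n := by lia
    calc (cavity lam R b (t + 1) X v).steps
      _ ≤ 4 + 2 * d * (3 * d + 4 + (X.length + 1) * (d + 1) + c * (2 * d + 1) ^ t) :=
        steps_cavity_succ_le fun u => ih u (by rw [List.length_cons]; lia)
      _ ≤ 4 + 2 * d * (3 * d + 4 + n * (d + 1) + c * (2 * d + 1) ^ t) := by gcongr
      _ = c + 2 * d * (c * (2 * d + 1) ^ t) := by rw [hc]; ring
      _ ≤ c * (2 * d + 1) ^ t + 2 * d * (c * (2 * d + 1) ^ t) := by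
        gcongr
        exact Nat.le_mul_of_pos_right _ (by positivity)
      _ = c * (2 * d + 1) ^ (t + 1) := by ring

theorem steps_cavity_nil_le (hd : 2 ≤ d) (lam : ℝ) (R : Set (Fin d → ℤ)) (b : ℝ) (t : ℕ)
    (v : Fin d → ℤ) : (cavity lam R b t [] v).steps ≤ d ^ (8 + 4 * t) := by
  have h2 : 2 ^ 2 ≤ d ^ 2 := Nat.pow_le_pow_left hd 2
  have h3 : 2 ^ 3 ≤ d ^ 3 := Nat.pow_le_pow_left hd 3
  have ht : t ≤ d ^ t := (Nat.lt_pow_self (by lia)).le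
  have hbase : 2 * d + 1 ≤ d ^ 3 := by nlinarith
  have hcoord : d + 1 ≤ d ^ 2 := by nlinarith
  have htest : 3 * d + 4 ≤ d ^ 4 := by nlinarith
  have hdeg : 2 * d ≤ d ^ 2 := by nlinarith
  have hthree : 3 ≤ d ^ 2 := by lia
  calc (cavity lam R b t [] v).steps
    _ ≤ (4 + 2 * d * (3 * d + 4 + t * (d + 1))) * (2 * d + 1) ^ t :=
      steps_cavity_le lam R b v (by simp)
    _ ≤ (d ^ 2 + d ^ 2 * (d ^ 4 + d ^ t * d ^ 2)) * (d ^ 3) ^ t := by gcongr; lia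
    _ = (d ^ 2 + d ^ 6 + d ^ (4 + t)) * d ^ (3 * t) := by ring
    _ ≤ (d ^ (6 + t) + d ^ (6 + t) + d ^ (6 + t)) * d ^ (3 * t) := by gcongr <;> lia
    _ = 3 * d ^ (6 + t) * d ^ (3 * t) := by ring
    _ ≤ d ^ 2 * d ^ (6 + t) * d ^ (3 * t) := by gcongr
    _ = d ^ (8 + 4 * t) := by ring

theorem val_logCavity (lam : ℝ) (R : Set (Fin d → ℤ)) (t : ℕ) :
    (logCavity lam R t).val = Real.log (cavityValue (latticeGraph d) lam t R 0) := by
  simp [logCavity, Timed.log, val_cavity]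

theorem steps_logCavity_le (hd : 2 ≤ d) (lam : ℝ) (R : Set (Fin d → ℤ)) (t : ℕ) :
    (logCavity lam R t).steps ≤ d ^ (9 + 4 * t) := by
  have hcavity := steps_cavity_nil_le hd lam R 1 t 0
  have hpow : d ^ 2 ≤ d ^ (8 + 4 * t) := Nat.pow_le_pow_right (by lia) (by lia)
  calc (logCavity lam R t).steps
    _ = d + ((cavity lam R 1 t [] 0).steps + 1) := rfl
    _ ≤ d * d ^ (8 + 4 * t) := by nlinarith
    _ = d ^ (9 + 4 * t) := by ring

theorem val_scaScale (d : ℕ) (lam : ℝ) : (scaScale d lam).val = √(1 + 2 * lam * d) := rfl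

theorem val_scaDepth (d : ℕ) (lam δ : ℝ) :
    (scaDepth d lam δ).val = 2 * ⌈10 * (√(1 + 2 * lam * d) * (1 + Real.log (1 + 1 / δ)))⌉₊ := rfl

theorem steps_scaDepth (d : ℕ) (lam δ : ℝ) :
    (scaDepth d lam δ).steps = 12 + (scaDepth d lam δ).val := by
  rw [val_scaDepth]
  simp only [scaDepth, scaScale, Timed.mul, Timed.add, Timed.div, Timed.sqrt, Timed.log,
    Timed.ceil, Timed.steps_bind, Timed.val_bind, Timed.val_instr, Timed.steps_instr]
  lia

theorem val_scaFreeEnergy (d : ℕ) (lam ε : ℝ) :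
    (scaFreeEnergy d lam ε).val =
      -Real.log (cavityValue (latticeGraph d) lam (scaDepth d lam ε).val (cavityHalf d) 0) := by
  simp [scaFreeEnergy, Timed.sub, val_logCavity]

theorem steps_scaFreeEnergy_le (hd : 2 ≤ d) (lam ε : ℝ) :
    (scaFreeEnergy d lam ε).steps ≤ d ^ (13 + 5 * (scaDepth d lam ε).val) := by
  set t := (scaDepth d lam ε).val with ht_def
  have hlog := steps_logCavity_le hd lam (cavityHalf d) t
  have ht : t < d ^ (9 + 4 * t) := (Nat.lt_pow_self (by lia)).trans_le
    (Nat.pow_le_pow_right (by lia) (by lia))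
  have h9 : 2 ^ 9 ≤ d ^ (9 + 4 * t) :=
    (Nat.pow_le_pow_left hd 9).trans (Nat.pow_le_pow_right (by lia) (by lia))
  have h4 : 2 ^ 4 ≤ d ^ (4 + t) :=
    (Nat.pow_le_pow_left hd 4).trans (Nat.pow_le_pow_right (by lia) (by lia))
  calc (scaFreeEnergy d lam ε).steps
    _ = 12 + t + ((logCavity lam (cavityHalf d) t).steps + 1) := by
      rw [ht_def, ← steps_scaDepth]
      rfl
    _ ≤ 2 ^ 4 * d ^ (9 + 4 * t) := by lia
    _ ≤ d ^ (4 + t) * d ^ (9 + 4 * t) := by gcongr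
    _ = d ^ (13 + 5 * t) := by ring

/-- The approximation of `faceExcess lam f k` by the cavity recursion of depth `t`. -/
noncomputable def truncatedFaceExcess (lam : ℝ) (t : ℕ) (f : Fin d × ℤˣ) (k : ℕ) : ℝ :=
  Real.log (cavityValue (latticeGraph d) lam t (cavityHalf d) 0) -
    Real.log (cavityValue (latticeGraph d) lam t (faceRegion f k) 0)

/-- The estimate of the surface pressure by the cavity recursion of depth `t`. -/
noncomputable def surfacePressureEstimate (lam : ℝ) (a : Fin d → ℝ) (t : ℕ) : ℝ :=
  ∑ j, 1 / a j / (∑ i, 1 / a i) *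
    ∑ σ : ℤˣ, ∑ k ∈ Finset.range t, truncatedFaceExcess lam t (j, σ) k

theorem sum_units_int (F : ℤˣ → ℝ) : ∑ σ, F σ = F 1 + F (-1) := by
  rw [UnitsInt.univ, Finset.sum_pair (by decide)]

theorem val_scaSurfacePressure (lam : ℝ) (a : Fin d → ℝ) (ε : ℝ) :
    (scaSurfacePressure d lam a ε).val =
      surfacePressureEstimate lam a (scaDepth d lam (ε / √(1 + 2 * lam * d))).val := by
  simp only [scaSurfacePressure, Timed.val_bind, Timed.div, Timed.val_instr, val_scaScale,
    val_logCavity, Timed.mul]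
  set t := (scaDepth d lam (ε / √(1 + 2 * lam * d))).val
  have htotal : ((List.finRange d).foldlM (fun w i => do
      Timed.tick
      let x ← Timed.instr 1 (1 / a i)
      Timed.add w x) (0 : ℝ)).val = ∑ i, 1 / a i := by
    rw [Timed.val_foldlM_add (g := fun i => 1 / a i) (fun _ _ => rfl), zero_add, Fin.sum_univ_def]
  rw [htotal, surfacePressureEstimate, Fin.sum_univ_def]
  refine (Timed.val_foldlM_add (fun r j => ?_) _ _).trans (zero_add _)
  simp only [Timed.val_bind, Timed.val_instr, Timed.add]
  congr 2
  rw [sum_units_int, ← Finset.sum_add_distrib]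
  refine (Timed.val_foldlM_add (fun c k => ?_) _ _).trans (zero_add _)
  simp only [Timed.val_bind, Timed.val_instr, Timed.sub, val_logCavity, truncatedFaceExcess,
    faceRegion_one, faceRegion_neg_one]
  ring

theorem steps_scaSurfacePressure_le_of_logCavity (a : Fin d → ℝ) (ε : ℝ) {t g : ℕ}
    (ht : (scaDepth d lam (ε / √(1 + 2 * lam * d))).val = t)
    (hg : ∀ R : Set (Fin d → ℤ), (logCavity lam R t).steps ≤ g) :
    (scaSurfacePressure d lam a ε).steps ≤
      18 + t + g + d * 3 + d * (5 + t * (4 + 2 * g)) := by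
  have hscale : (scaScale d lam).steps = 4 := rfl
  have hle : (scaSurfacePressure d lam a ε).steps ≤
      4 + (1 + (12 + t + (g + (1 + (d * 3 + d * (5 + t * (4 + 2 * g))))))) := by
    simp only [scaSurfacePressure, Timed.steps_bind, Timed.div, Timed.val_instr,
      Timed.steps_instr, val_scaScale, hscale, steps_scaDepth, ht, Timed.mul]
    gcongr
    · exact hg _
    · refine (Timed.steps_foldlM_le (c := 3) (fun _ _ => le_rfl) _ _).trans_eq ?_
      rw [List.length_finRange]
    · refine (Timed.steps_foldlM_le (c := 5 + t * (4 + 2 * g)) (fun r j => ?_) _ _).trans_eq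
        (by rw [List.length_finRange])
      have hloop : ∀ f : ℝ → ℕ → Timed ℝ, (∀ c k, (f c k).steps ≤ 4 + 2 * g) →
          ((List.range t).foldlM f 0).steps ≤ t * (4 + 2 * g) := fun f hf =>
        (Timed.steps_foldlM_le hf _ _).trans_eq (by rw [List.length_range])
      simp only [Timed.steps_bind, Timed.steps_instr, Timed.tick, Timed.add]
      refine (Nat.add_le_add_left (Nat.add_le_add_right (hloop _ fun c k => ?_) _) _).trans
        (by lia)
      have hupper := hg (cavityUpper d j k)
      have hlower := hg (cavityLower d j k)
      simp only [Timed.steps_bind, Timed.steps_instr, Timed.sub]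
      lia
  exact hle.trans_eq (by ring)

theorem steps_scaSurfacePressure_le (hd : 2 ≤ d) (lam : ℝ) (a : Fin d → ℝ) (ε : ℝ) :
    (scaSurfacePressure d lam a ε).steps ≤
      d ^ (13 + 5 * (scaDepth d lam (ε / √(1 + 2 * lam * d))).val) := by
  set t := (scaDepth d lam (ε / √(1 + 2 * lam * d))).val with ht_def
  set g := d ^ (9 + 4 * t) with hg
  have ht : t ≤ d ^ t := (Nat.lt_pow_self (by lia)).le
  have hpos : 1 ≤ d ^ t := Nat.one_le_pow _ _ (by lia)
  have htg : d ^ t ≤ g := Nat.pow_le_pow_right (by lia) (by lia)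
  have h9 : 2 ^ 9 ≤ g :=
    (Nat.pow_le_pow_left hd 9).trans (Nat.pow_le_pow_right (by lia) (by lia))
  have hdg : d * 3 ≤ g := calc
    d * 3 ≤ d ^ 3 := by nlinarith [Nat.pow_le_pow_left hd 2]
    _ ≤ g := Nat.pow_le_pow_right (by lia) (by lia)
  have hgt : g ≤ d ^ t * g := Nat.le_mul_of_pos_left _ hpos
  have hgd : d ^ t * g ≤ d * (d ^ t * g) := Nat.le_mul_of_pos_left _ (by lia)
  calc (scaSurfacePressure d lam a ε).steps
    _ ≤ 18 + t + g + d * 3 + d * (5 + t * (4 + 2 * g)) :=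
      steps_scaSurfacePressure_le_of_logCavity a ε ht_def.symm fun R =>
        steps_logCavity_le hd lam R t
    _ ≤ 4 * g + d * (g + d ^ t * (g + 2 * g)) := by
      gcongr <;> lia
    _ ≤ 4 * (d * (d ^ t * g)) + d * (d ^ t * g + d ^ t * (g + 2 * g)) := by
      gcongr
      exact hgt.trans hgd
    _ = 2 ^ 3 * (d * d ^ t * g) := by ring
    _ ≤ d ^ 3 * (d * d ^ t * g) := by gcongr
    _ = d ^ (13 + 5 * t) := by rw [hg]; ring

end

/-! ### Accuracy of the algorithm -/

section

variable {d : ℕ} {lam : ℝ}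

theorem two_pow_ten_le_exp_ten : (2 : ℝ) ^ 10 ≤ Real.exp 10 := by
  calc (2 : ℝ) ^ 10 ≤ Real.exp 1 ^ 10 := by
        gcongr
        linarith [Real.add_one_le_exp (1 : ℝ)]
    _ = Real.exp 10 := by rw [← Real.exp_nat_mul]; norm_num

theorem log_one_add_one_div_nonneg {δ : ℝ} (hδ : 0 < δ) : 0 ≤ Real.log (1 + 1 / δ) :=
  Real.log_nonneg (le_add_of_nonneg_right (one_div_pos.2 hδ).le)

theorem exp_neg_div_le {m s δ : ℝ} (hδ : 0 < δ) (hs : 0 < s)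
    (hm : 10 * (s * (1 + Real.log (1 + 1 / δ))) ≤ m) : Real.exp (-(m / s)) ≤ δ / 2 ^ 10 := by
  have hlog := log_one_add_one_div_nonneg hδ
  have hdiv : 10 + Real.log (1 + 1 / δ) ≤ m / s := by
    rw [le_div_iff₀ hs]
    nlinarith [mul_nonneg hs.le hlog]
  rw [Real.exp_neg, inv_le_comm₀ (Real.exp_pos _) (by positivity)]
  calc (δ / 2 ^ 10)⁻¹
    _ = 2 ^ 10 * (1 / δ) := by field_simp
    _ ≤ Real.exp 10 * (1 + 1 / δ) := by
      gcongr
      · exact two_pow_ten_le_exp_ten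
      · linarith
    _ = Real.exp (10 + Real.log (1 + 1 / δ)) := by rw [Real.exp_add, Real.exp_log (by positivity)]
    _ ≤ Real.exp (m / s) := Real.exp_le_exp.2 hdiv

theorem exists_val_scaDepth_eq_two_mul {δ : ℝ} (hlam : 0 ≤ lam) (hδ : 0 < δ) :
    ∃ m : ℕ, (scaDepth d lam δ).val = 2 * m ∧ √(1 + 2 * lam * d) ≤ m ∧
      Real.exp (-(m / √(1 + 2 * lam * d))) ≤ δ / 2 ^ 10 := by
  set s := √(1 + 2 * lam * d)
  have hs : 0 < s := Real.sqrt_pos.2 (by positivity)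
  have hlog := log_one_add_one_div_nonneg hδ
  have hceil := Nat.le_ceil (10 * (s * (1 + Real.log (1 + 1 / δ))))
  refine ⟨_, val_scaDepth d lam δ, le_trans ?_ hceil, exp_neg_div_le hδ hs hceil⟩
  nlinarith [mul_nonneg hs.le hlog]

theorem mul_exp_neg_div_le {s : ℝ} (hs : 0 < s) (x : ℝ) : x * Real.exp (-(x / s)) ≤ s :=
  calc x * Real.exp (-(x / s))
    _ = s * (x / s * Real.exp (-(x / s))) := by field_simp
    _ ≤ s * 1 := by
      gcongr
      exact (Real.mul_exp_neg_le_exp_neg_one _).trans (Real.exp_le_one_iff.2 (by norm_num))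
    _ = s := mul_one s

theorem exists_hasSum_exp_neg_div_le {s : ℝ} (hs : 0 < s) :
    ∃ σ ≤ s, HasSum (fun k : ℕ => Real.exp (-((k + 1) / s))) σ := by
  set r := Real.exp (-(1 / s)) with hr
  have hr_lt : r < 1 := Real.exp_lt_one_iff.2 (neg_lt_zero.2 (by positivity))
  have hinv : r⁻¹ = Real.exp (1 / s) := by rw [hr, Real.exp_neg, inv_inv]
  refine ⟨r * (1 - r)⁻¹, ?_, ?_⟩
  · have hr_pos : 0 < r := Real.exp_pos _
    have hle : 1 / s + 1 ≤ r⁻¹ := hinv ▸ Real.add_one_le_exp _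
    calc r * (1 - r)⁻¹
      _ = (r⁻¹ - 1)⁻¹ := by rw [← inv_inv r, ← mul_inv]; field_simp
      _ ≤ (1 / s)⁻¹ := by gcongr; linarith
      _ = s := by rw [one_div, inv_inv]
  · have hterm : ∀ k : ℕ, Real.exp (-((k + 1) / s)) = r * r ^ k := fun k => by
      rw [← pow_succ', hr, ← Real.exp_nat_mul]
      congr 1
      push_cast
      ring
    simpa only [hterm] using (hasSum_geometric_of_lt_one (Real.exp_pos _).le hr_lt).mul_left r

theorem cavityError_two_mul_add_le {D : ℝ} (hD : 0 ≤ D) {m : ℕ} (hm : √(1 + D) ≤ m) (k : ℕ) :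
    cavityError D (k + 2 * m) ≤
      16 * Real.exp (-(m / √(1 + D))) ^ 2 * Real.exp (-((k + 1) / √(1 + D))) := by
  refine (cavityError_le_sixteen_mul_exp hD ?_).trans_eq ?_
  · push_cast
    linarith [k.cast_nonneg (α := ℝ)]
  rw [mul_assoc, ← Real.exp_nat_mul, ← Real.exp_add]
  congr 2
  push_cast
  ring

theorem cavityError_two_mul_le {D : ℝ} (hD : 0 ≤ D) {m : ℕ} (hm : √(1 + D) ≤ m) :
    cavityError D (2 * m) ≤ 16 * Real.exp (-(m / √(1 + D))) ^ 2 := by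
  have h := cavityError_two_mul_add_le hD hm 0
  rw [zero_add] at h
  exact h.trans (mul_le_of_le_one_right (by positivity)
    (Real.exp_le_one_iff.2 (neg_nonpos.2 (by positivity))))

theorem exp_neg_div_sq_le (m : ℕ) {s : ℝ} (hs : 0 ≤ s) :
    Real.exp (-(m / s)) ^ 2 ≤ Real.exp (-(m / s)) :=
  pow_le_of_le_one (Real.exp_pos _).le
    (Real.exp_le_one_iff.2 (neg_nonpos.2 (by positivity))) two_ne_zero

theorem abs_scaFreeEnergy_sub_le {ε : ℝ} (hlam : 0 ≤ lam) (hε : 0 < ε) :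
    |(scaFreeEnergy d lam ε).val - freeEnergy d lam| ≤ ε := by
  obtain ⟨m, hdepth, hm, hexp⟩ := exists_val_scaDepth_eq_two_mul (d := d) hlam hε
  have hD : 0 ≤ 2 * lam * d := by positivity
  rw [val_scaFreeEnergy, hdepth, freeEnergy, ← neg_sub', abs_neg]
  calc _ ≤ cavityError (2 * lam * d) (2 * m) := abs_log_cavityValue_sub_logCavityLimit_le hlam
        (degree_latticeGraph_mul_le hlam) _ _ _
    _ ≤ 16 * Real.exp (-(m / √(1 + 2 * lam * d))) ^ 2 := cavityError_two_mul_le hD hm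
    _ ≤ 16 * Real.exp (-(m / √(1 + 2 * lam * d))) := by
      gcongr
      exact exp_neg_div_sq_le m (by positivity)
    _ ≤ ε := by linarith

theorem abs_truncatedFaceExcess_sub_faceExcess_le (hlam : 0 ≤ lam) (t : ℕ) (f : Fin d × ℤˣ)
    (k : ℕ) :
    |truncatedFaceExcess lam t f k - faceExcess lam f k| ≤ 2 * cavityError (2 * lam * d) t := by
  have hlimit := fun R => abs_log_cavityValue_sub_logCavityLimit_le hlam
    (degree_latticeGraph_mul_le (d := d) hlam) R 0 t
  rw [truncatedFaceExcess, faceExcess, sub_sub_sub_comm, two_mul]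
  exact (abs_sub _ _).trans (add_le_add (hlimit _) (hlimit _))

theorem abs_sum_truncatedFaceExcess_sub_sum_faceExcess_le (hlam : 0 ≤ lam) (t : ℕ)
    (f : Fin d × ℤˣ) :
    |∑ k ∈ Finset.range t, truncatedFaceExcess lam t f k -
      ∑ k ∈ Finset.range t, faceExcess lam f k| ≤ t * (2 * cavityError (2 * lam * d) t) := by
  rw [← Finset.sum_sub_distrib]
  refine (Finset.abs_sum_le_sum_abs _ _).trans ((Finset.sum_le_card_nsmul _ _ _ fun k _ =>
    abs_truncatedFaceExcess_sub_faceExcess_le hlam t f k).trans_eq ?_)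
  rw [Finset.card_range, nsmul_eq_mul]

theorem abs_tsum_faceExcess_add_two_mul_le (hlam : 0 ≤ lam) {m : ℕ} (hm : √(1 + 2 * lam * d) ≤ m)
    (f : Fin d × ℤˣ) :
    |∑' k, faceExcess lam f (k + 2 * m)| ≤
      32 * Real.exp (-(m / √(1 + 2 * lam * d))) ^ 2 * √(1 + 2 * lam * d) := by
  have hD : 0 ≤ 2 * lam * d := by positivity
  obtain ⟨σ, hσ, hsum⟩ :=
    exists_hasSum_exp_neg_div_le (Real.sqrt_pos.2 (by positivity : 0 < 1 + 2 * lam * d))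
  refine (tsum_of_norm_bounded (f := fun k => faceExcess lam f (k + 2 * m)) (hsum.mul_left
    (32 * Real.exp (-(m / √(1 + 2 * lam * d))) ^ 2)) fun k => ?_).trans (by gcongr)
  rw [Real.norm_eq_abs]
  linarith [abs_faceExcess_le hlam f (k + 2 * m), cavityError_two_mul_add_le hD hm k]

theorem abs_sum_truncatedFaceExcess_sub_tsum_faceExcess_le (hlam : 0 ≤ lam) {m : ℕ}
    (hm : √(1 + 2 * lam * d) ≤ m) (f : Fin d × ℤˣ) :
    |∑ k ∈ Finset.range (2 * m), truncatedFaceExcess lam (2 * m) f k -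
      ∑' k, faceExcess lam f k| ≤
      96 * √(1 + 2 * lam * d) * Real.exp (-(m / √(1 + 2 * lam * d))) := by
  have herror := cavityError_two_mul_le (by positivity : 0 ≤ 2 * lam * d) hm
  have hhead := abs_sum_truncatedFaceExcess_sub_sum_faceExcess_le hlam (2 * m) f
  have htail := abs_tsum_faceExcess_add_two_mul_le hlam hm f
  rw [← (summable_faceExcess hlam f).sum_add_tsum_nat_add (2 * m), ← sub_sub]
  set s := √(1 + 2 * lam * d)
  have hs : 0 < s := Real.sqrt_pos.2 (by positivity)
  have hm_le := mul_exp_neg_div_le hs m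
  have hsq := exp_neg_div_sq_le m hs.le
  set e := Real.exp (-(m / s))
  calc _ ≤ ((2 * m : ℕ) : ℝ) * (2 * cavityError (2 * lam * d) (2 * m)) + 32 * e ^ 2 * s :=
        (abs_sub _ _).trans (add_le_add hhead htail)
    _ ≤ ((2 * m : ℕ) : ℝ) * (2 * (16 * e ^ 2)) + 32 * e * s := by gcongr
    _ = 64 * (m * e) * e + 32 * e * s := by push_cast; ring
    _ ≤ 64 * s * e + 32 * e * s := by gcongr
    _ = 96 * s * e := by ring

theorem area_div_surfaceArea {a : Fin d → ℝ} (ha : ∀ i, 0 < a i) (j : Fin d) :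
    (∏ k ∈ Finset.univ.erase j, 2 * a k) / surfaceArea a = 1 / a j / ∑ i, 1 / a i := by
  have hprod : ∀ i, ∏ k ∈ Finset.univ.erase i, 2 * a k = (∏ k, 2 * a k) / 2 * (1 / a i) := by
    intro i
    rw [← Finset.mul_prod_erase Finset.univ _ (Finset.mem_univ i)]
    have := (ha i).ne'
    field_simp
  have hpos : 0 < (∏ k, 2 * a k) / 2 :=
    half_pos (Finset.prod_pos fun k _ => mul_pos two_pos (ha k))
  simp only [surfaceArea, hprod]
  rw [← Finset.mul_sum, mul_div_mul_left _ _ hpos.ne']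

theorem surfacePressure_eq_sum {a : Fin d → ℝ} (ha : ∀ i, 0 < a i) :
    surfacePressure lam a =
      ∑ j, 1 / a j / (∑ i, 1 / a i) * ∑ σ : ℤˣ, ∑' k, faceExcess lam (j, σ) k := by
  rw [surfacePressure, Finset.sum_div, Fintype.sum_prod_type]
  refine Finset.sum_congr rfl fun j _ => ?_
  rw [← area_div_surfaceArea ha j, Finset.mul_sum]
  exact Finset.sum_congr rfl fun σ _ => mul_div_right_comm _ _ _

theorem abs_surfacePressureEstimate_sub_le (hd : 0 < d) (hlam : 0 ≤ lam) {m : ℕ}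
    (hm : √(1 + 2 * lam * d) ≤ m) {a : Fin d → ℝ} (ha : ∀ i, 0 < a i) :
    |surfacePressureEstimate lam a (2 * m) - surfacePressure lam a| ≤
      192 * √(1 + 2 * lam * d) * Real.exp (-(m / √(1 + 2 * lam * d))) := by
  have : Nonempty (Fin d) := ⟨⟨0, hd⟩⟩
  have htotal : 0 < ∑ i, 1 / a i :=
    Finset.sum_pos (fun i _ => one_div_pos.2 (ha i)) Finset.univ_nonempty
  rw [surfacePressure_eq_sum ha, surfacePressureEstimate, ← Finset.sum_sub_distrib]
  set B := 192 * √(1 + 2 * lam * d) * Real.exp (-(m / √(1 + 2 * lam * d)))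
  calc _ ≤ ∑ j, 1 / a j / (∑ i, 1 / a i) * B := by
        refine (Finset.abs_sum_le_sum_abs _ _).trans (Finset.sum_le_sum fun j _ => ?_)
        have hweight : 0 ≤ 1 / a j / ∑ i, 1 / a i :=
          div_nonneg (one_div_pos.2 (ha j)).le htotal.le
        rw [← mul_sub, abs_mul, abs_of_nonneg hweight, sum_units_int, sum_units_int,
          add_sub_add_comm]
        gcongr
        refine (abs_add_le _ _).trans ?_
        linarith [abs_sum_truncatedFaceExcess_sub_tsum_faceExcess_le hlam hm (j, 1),
          abs_sum_truncatedFaceExcess_sub_tsum_faceExcess_le hlam hm (j, -1)]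
    _ = B := by rw [← Finset.sum_mul, ← Finset.sum_div, div_self htotal.ne', one_mul]

theorem abs_scaSurfacePressure_sub_le {ε : ℝ} (hd : 0 < d) (hlam : 0 ≤ lam) (hε : 0 < ε)
    {a : Fin d → ℝ} (ha : ∀ i, 0 < a i) :
    |(scaSurfacePressure d lam a ε).val - surfacePressure lam a| ≤ ε := by
  have hs : 0 < √(1 + 2 * lam * d) := Real.sqrt_pos.2 (by positivity)
  obtain ⟨m, hdepth, hm, hexp⟩ := exists_val_scaDepth_eq_two_mul (d := d) hlam (div_pos hε hs)
  rw [val_scaSurfacePressure, hdepth]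
  refine (abs_surfacePressureEstimate_sub_le hd hlam hm ha).trans ?_
  set s := √(1 + 2 * lam * d)
  calc 192 * s * Real.exp (-(m / s)) ≤ 192 * s * (ε / s / 2 ^ 10) := by gcongr
    _ = 192 / 2 ^ 10 * ε := by field_simp
    _ ≤ ε := by linarith

end

/-! ### Running time of the algorithm -/

section

variable {d : ℕ} {lam : ℝ}

theorem one_le_sqrt_mul_one_add_log (d : ℕ) {δ : ℝ} (hlam : 0 ≤ lam) (hδ : 0 < δ) :
    1 ≤ √(1 + 2 * lam * d) * (1 + Real.log (1 + 1 / δ)) :=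
  one_le_mul_of_one_le_of_one_le
    (Real.one_le_sqrt.2 (le_add_of_nonneg_right (by positivity)))
    (le_add_of_nonneg_right (log_one_add_one_div_nonneg hδ))

theorem twenty_le_val_scaDepth (d : ℕ) {δ : ℝ} (hlam : 0 ≤ lam) (hδ : 0 < δ) :
    20 ≤ (scaDepth d lam δ).val := by
  have hone := one_le_sqrt_mul_one_add_log d hlam hδ
  rw [val_scaDepth]
  set x := √(1 + 2 * lam * d) * (1 + Real.log (1 + 1 / δ))
  have hceil : 10 ≤ ⌈10 * x⌉₊ := by
    exact_mod_cast (by linarith : (10 : ℝ) ≤ 10 * x).trans (Nat.le_ceil _)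
  lia

theorem val_scaDepth_le (d : ℕ) {δ : ℝ} (hlam : 0 ≤ lam) (hδ : 0 < δ) :
    ((scaDepth d lam δ).val : ℝ) ≤
      22 * (√(1 + 2 * lam * d) * (1 + Real.log (1 + 1 / δ))) := by
  have hone := one_le_sqrt_mul_one_add_log d hlam hδ
  rw [val_scaDepth]
  set x := √(1 + 2 * lam * d) * (1 + Real.log (1 + 1 / δ))
  have hceil := (Nat.ceil_lt_add_one (by linarith : 0 ≤ 10 * x)).le
  push_cast
  linarith

theorem pow_le_rpow_of_depth_le {B L : ℝ} (hd : 0 < d) (hlam : 0 ≤ lam) (hB : 1 ≤ B) {t : ℕ}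
    (ht : 1 ≤ t) (htL : t ≤ 22 * (√(1 + 2 * lam * d) * (1 + L))) (hL : 1 + L ≤ 4 * Real.log B) :
    (d : ℝ) ^ (6 * t + 1) ≤ B ^ (2000 * √(1 + lam * d) * Real.log d) := by
  have hlogB : 0 ≤ Real.log B := Real.log_nonneg hB
  have hsqrt : √(1 + 2 * lam * d) ≤ 2 * √(1 + lam * d) := by
    rw [Real.sqrt_le_left (by positivity), mul_pow, Real.sq_sqrt (by positivity)]
    linarith [(by positivity : 0 ≤ lam * d)]
  have hdepth : √(1 + 2 * lam * d) * (1 + L) ≤ 2 * √(1 + lam * d) * (4 * Real.log B) :=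
    calc √(1 + 2 * lam * d) * (1 + L)
      _ ≤ √(1 + 2 * lam * d) * (4 * Real.log B) := by gcongr
      _ ≤ 2 * √(1 + lam * d) * (4 * Real.log B) := by gcongr
  have hexponent : ((6 * t + 1 : ℕ) : ℝ) ≤ 2000 * (√(1 + lam * d) * Real.log B) := by
    have ht' : (1 : ℝ) ≤ t := by exact_mod_cast ht
    push_cast
    linarith [(by positivity : 0 ≤ √(1 + lam * d) * Real.log B)]
  rw [Real.rpow_def_of_pos (by linarith), ← Real.log_le_iff_le_exp (by positivity), Real.log_pow]
  calc ((6 * t + 1 : ℕ) : ℝ) * Real.log d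
    _ ≤ 2000 * (√(1 + lam * d) * Real.log B) * Real.log d := by gcongr
    _ = Real.log B * (2000 * √(1 + lam * d) * Real.log d) := by ring

theorem one_div_le_log (hd : 2 ≤ d) (hlam : 0 ≤ lam) :
    1 / (d : ℝ) ≤ Real.log (2 + 2 * lam * d) := by
  calc 1 / (d : ℝ) ≤ 1 / 2 := one_div_le_one_div_of_le two_pos (by exact_mod_cast hd)
    _ ≤ Real.log 2 := by linarith [Real.log_two_gt_d9]
    _ ≤ Real.log (2 + 2 * lam * d) :=
      Real.log_le_log two_pos (le_add_of_nonneg_right (by positivity))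

theorem natCast_le_log_mul_rpow {B L : ℝ} (hd : 2 ≤ d) (hlam : 0 ≤ lam) (hB : 1 ≤ B) {t n : ℕ}
    (ht : 20 ≤ t) (htL : t ≤ 22 * (√(1 + 2 * lam * d) * (1 + L))) (hL : 1 + L ≤ 4 * Real.log B)
    (hn : n ≤ d ^ (13 + 5 * t)) :
    (n : ℝ) ≤ Real.log (2 + 2 * lam * d) * B ^ (2000 * √(1 + lam * d) * Real.log d) := by
  have hd_pos : 0 < (d : ℝ) := by exact_mod_cast two_pos.trans_le hd
  have hpow : n ≤ d ^ (6 * t) := hn.trans (Nat.pow_le_pow_right (by lia) (by lia))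
  calc (n : ℝ) ≤ (d : ℝ) ^ (6 * t) := by exact_mod_cast hpow
    _ = 1 / d * (d : ℝ) ^ (6 * t + 1) := by rw [pow_succ]; field_simp
    _ ≤ _ := mul_le_mul (one_div_le_log hd hlam)
      (pow_le_rpow_of_depth_le (by lia) hlam hB (by lia) htL hL) (by positivity)
      ((one_div_pos.2 hd_pos).le.trans (one_div_le_log hd hlam))

theorem steps_scaFreeEnergy_le_rpow {ε : ℝ} (hd : 2 ≤ d) (hlam : 0 ≤ lam) (hε : 0 < ε) :
    ((scaFreeEnergy d lam ε).steps : ℝ) ≤ Real.log (2 + 2 * lam * d) *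
      (2 + 1 / ε) ^ (2000 * √(1 + lam * d) * Real.log d) := by
  have hε_inv : 0 < 1 / ε := one_div_pos.2 hε
  refine natCast_le_log_mul_rpow hd hlam (by linarith) (twenty_le_val_scaDepth d hlam hε)
    (val_scaDepth_le d hlam hε) ?_ (steps_scaFreeEnergy_le hd lam ε)
  have hlog_two : Real.log 2 ≤ Real.log (2 + 1 / ε) := Real.log_le_log two_pos (by linarith)
  have hlog : Real.log (1 + 1 / ε) ≤ Real.log (2 + 1 / ε) :=
    Real.log_le_log (by linarith) (by linarith)
  linarith [Real.log_two_gt_d9]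

theorem log_one_add_one_div_div_sqrt_le {x ε : ℝ} (hx : 0 ≤ x) (hε : 0 < ε) :
    Real.log (1 + 1 / (ε / √(1 + 2 * x))) ≤ 2 * Real.log (2 + x + 1 / ε) := by
  have hε_inv : 0 < 1 / ε := one_div_pos.2 hε
  have hsqrt : √(1 + 2 * x) ≤ 1 + x := by
    rw [Real.sqrt_le_left (by linarith)]
    nlinarith [sq_nonneg x]
  calc Real.log (1 + 1 / (ε / √(1 + 2 * x)))
    _ = Real.log (1 + √(1 + 2 * x) * (1 / ε)) := by rw [one_div_div, div_eq_mul_one_div]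
    _ ≤ Real.log (1 + (1 + x) * (1 / ε)) := by gcongr
    _ ≤ Real.log ((2 + x + 1 / ε) ^ 2) := by
      gcongr
      nlinarith [mul_nonneg hx hε_inv.le]
    _ = 2 * Real.log (2 + x + 1 / ε) := by rw [Real.log_pow, Nat.cast_two]

theorem steps_scaSurfacePressure_le_rpow {ε : ℝ} (hd : 2 ≤ d) (hlam : 0 ≤ lam) (hε : 0 < ε)
    (a : Fin d → ℝ) :
    ((scaSurfacePressure d lam a ε).steps : ℝ) ≤ Real.log (2 + 2 * lam * d) *
      (2 + lam * d + 1 / ε) ^ (2000 * √(1 + lam * d) * Real.log d) := by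
  have hε_inv : 0 < 1 / ε := one_div_pos.2 hε
  have hlam_mul : 0 ≤ lam * d := by positivity
  have hδ : 0 < ε / √(1 + 2 * lam * d) := by positivity
  refine natCast_le_log_mul_rpow hd hlam (by linarith) (twenty_le_val_scaDepth d hlam hδ)
    (val_scaDepth_le d hlam hδ) ?_ (steps_scaSurfacePressure_le hd lam a ε)
  have hlog_two : Real.log 2 ≤ Real.log (2 + lam * d + 1 / ε) :=
    Real.log_le_log two_pos (by linarith)
  have hlog := log_one_add_one_div_div_sqrt_le hlam_mul hε
  rw [← mul_assoc] at hlog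
  linarith [Real.log_two_gt_d9]

end

theorem proposition4 :
    ∃ C : ℝ, 0 < C ∧ ∀ d : ℕ, 2 ≤ d → ∀ lam : ℝ, 0 < lam →
      ∃ P : ℝ, IsFreeEnergy d lam P ∧
        (∀ ε : ℝ, 0 < ε →
          |(scaFreeEnergy d lam ε).val - P| ≤ ε ∧
          ((scaFreeEnergy d lam ε).steps : ℝ) ≤
            Real.log (2 + 2 * lam * d) *
              (2 + 1 / ε) ^ (C * Real.sqrt (1 + lam * d) * Real.log d)) ∧
        ∀ a : Fin d → ℝ, (∀ i, 0 < a i) →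
          ∃ s : ℝ, IsSurfacePressure d lam P a s ∧
            ∀ ε : ℝ, 0 < ε →
              |(scaSurfacePressure d lam a ε).val - s| ≤ ε ∧
              ((scaSurfacePressure d lam a ε).steps : ℝ) ≤
                Real.log (2 + 2 * lam * d) *
                  (2 + lam * d + 1 / ε) ^ (C * Real.sqrt (1 + lam * d) * Real.log d) := by
  refine ⟨2000, by norm_num, fun d hd lam hlam => ⟨freeEnergy d lam, ?_, ?_, ?_⟩⟩
  · exact isFreeEnergy_freeEnergy hlam.le
  · exact fun ε hε =>
      ⟨abs_scaFreeEnergy_sub_le hlam.le hε, steps_scaFreeEnergy_le_rpow hd hlam.le hε⟩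
  · intro a ha
    have hd_pos : 0 < d := two_pos.trans_le hd
    exact ⟨surfacePressure lam a, isSurfacePressure_surfacePressure hd_pos hlam.le ha, fun ε hε =>
      ⟨abs_scaSurfacePressure_sub_le hd_pos hlam.le hε ha,
        steps_scaSurfacePressure_le_rpow hd hlam.le hε a⟩⟩
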